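/- Let $(W,S)$ be a Coxeter system with $S$ finite and length function $l$, let $\Gamma$ be a totally ordered abelian group (written additively, with order compatible with addition), and let $L\colon W\to\Gamma$ be a weight function, i.e. $L(ww')=L(w)+L(w')$ whenever $l(ww')=l(w)+l(w')$; assume $L(s)>0$ for all $s\in S$. Let $A=\mathbb{Z}[\Gamma]$ with $\mathbb Z$-basis $\{e^\gamma\mid\gamma\in\Gamma\}$, $e^\gamma e^{\gamma'}=e^{\gamma+\gamma'}$, let $\overline{e^{\gamma}}=e^{-\gamma}$, let $A_{<0}=\langle e^\gamma\mid\gamma<0\rangle_{\mathbb{Z}}$, and put $q_s=e^{L(s)}$ for $s\in S$. Let $\mathcal{H}$ be the generic Iwahori--Hecke algebra over $A$, with basis $\{T_w\mid w\in W\}$ and multiplication given, for $s\in S$ and $w\in W$, by $T_sT_w=T_{sw}$ if $l(sw)>l(w)$ and $T_sT_w=T_{sw}+(q_s-q_s^{-1})T_w$ if $l(sw)<l(w)$. Let $\overline{\sum_w a_wT_w}=\sum_w\overline{a}_wT_{w^{-1}}^{-1}$, and let $\{\mathbf{C}_w\mid w\in W\}$ be the Kazhdan--Lusztig basis: $\overline{\mathbf{C}}_w=\mathbf{C}_w$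 and $\mathbf{C}_w\equiv T_w \bmod \sum_{y\in W}A_{<0}T_y$. Define $h_{x,y,z}\in A$ by $\mathbf{C}_x\mathbf{C}_y=\sum_{z}h_{x,y,z}\mathbf{C}_z$. Let $\leq_{\mathcal L}$ be the reflexive and transitive relation on $W$ generated by the pairs $x\leq_{\mathcal L}y$ for which $h_{s,y,x}\neq0$ for some $s\in S$. The left cells of $W$ are the equivalence classes of the relation "$x\leq_{\mathcal L}y$ and $y\leq_{\mathcal L}x$". For unions of left cells $\mathfrak{C},\mathfrak{C}_1$ of $W$ we say that a bijection $\mathfrak{C}\to\mathfrak{C}_1$, $x\mapsto x_1$, satisfies $(\heartsuit)$ if $$h_{w,x,y}=h_{w,x_1,y_1}\qquad\text{for all } w\in W \text{ and } x,y\in\mathfrak{C},$$ and we write $\mathfrak{C}\approx\mathfrak{C}_1$ if such a bijection exists. For $I\subseteq S$ let $W_I=\langle I\rangle$ and let $X_I$ be the set of all $w\in W$ that have minimal length in $wW_I$. All the notions above apply also to the Coxeter group $(W_I,I)$ with the weight function $L|_{W_I}$. Let $\mathfrak{C},\mathfrak{C}_1$ be left cells of $W_I$ with $\mathfrak{C}\approx\mathfrak{C}_1$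 (with respect to $W_I$), and let $\mathfrak{C}\to\mathfrak{C}_1$, $u\mapsto u_1$, be a bijection satisfying $(\heartsuit)$ with respect to $W_I$. Then: 1. The rule $xu\mapsto xu_1$ $(x\in X_I,\ u\in\mathfrak{C})$ defines a bijection $X_I\mathfrak{C}\to X_I\mathfrak{C}_1$, and this bijection satisfies $(\heartsuit)$ with respect to $W$. 2. $X_I\mathfrak{C}$ and $X_I\mathfrak{C}_1$ are unions of left cells of $W$, and $X_I\mathfrak{C}\approx X_I\mathfrak{C}_1$. 3. If $X_I\mathfrak{C}=\coprod_{\alpha\in\mathcal{A}}\mathfrak{C}^{(\alpha)}$ and $X_I\mathfrak{C}_1=\coprod_{\beta\in\mathcal{B}}\mathfrak{C}_1^{(\beta)}$ are the partitions into left cells of $W$, then there is a bijection $f\colon\mathcal{A}\to\mathcal{B}$ such that $\mathfrak{C}^{(\alpha)}\approx\mathfrak{C}_1^{(f(\alpha))}$ for all $\alpha\in\mathcal{A}$. -/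

import Mathlib

/-!
Iwahori--Hecke algebras of Coxeter groups with a weight function with values in a totally
ordered abelian group, the Kazhdan--Lusztig basis and left cells.

The definitions take a group `G`, a family `s : B → G` of generators and a function `L : G → Γ`.
They are used for a Coxeter group `W` with its simple reflections, and for a standard parabolic
subgroup `W_I` with the simple reflections in `I` (again a Coxeter group) and the restriction of
the weight function to `W_I`.
-/

noncomputable section

namespace KLCells

variable {B G Γ : Type*} [Group G] [AddCommGroup Γ] [LinearOrder Γ]

/-! ### The length function -/

/-- The length of `w` with respect to the generators `s i` (which are involutions in all uses):
the smallest length of a word in the `s i` with product `w`. -/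
def wordLength (s : B → G) (w : G) : ℕ :=
  sInf {n | ∃ ω : List B, ω.length = n ∧ (ω.map s).prod = w}

/-- The word `ω` is a reduced expression of `w`. -/
def IsReducedWord (s : B → G) (w : G) (ω : List B) : Prop :=
  (ω.map s).prod = w ∧ ω.length = wordLength s w

/-- A reduced expression of `w`. -/
def reducedWord (s : B → G) (w : G) : List B :=
  Classical.epsilon (IsReducedWord s w)

/-- For a Coxeter system this is the length function of Mathlib. -/
theorem wordLength_simple {M : CoxeterMatrix B} (cs : CoxeterSystem M G) (w : G) :
    wordLength cs.simple w = cs.length w := by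
  obtain ⟨ω, hω, hw⟩ := cs.exists_isReduced w
  apply le_antisymm
  · refine Nat.sInf_le ⟨ω, ?_, ?_⟩
    · rw [hw]; exact hω.eq.symm
    · rw [hw]; rfl
  · have hne : {n | ∃ ω : List B, ω.length = n ∧ (ω.map cs.simple).prod = w}.Nonempty :=
      ⟨_, ω, rfl, hw.symm⟩
    obtain ⟨ω', h1, h2⟩ := Nat.sInf_mem hne
    calc cs.length w = cs.length (cs.wordProd ω') := by rw [← h2]; rfl
      _ ≤ ω'.length := cs.length_wordProd_le ω'
      _ = _ := h1

/-! ### The coefficient ring `A = ℤ[Γ]` -/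

/-- The group ring `A = ℤ[Γ]`. -/
def CoeffRing (Γ : Type*) : Type _ := AddMonoidAlgebra ℤ Γ

instance : CommRing (CoeffRing Γ) := inferInstanceAs (CommRing (AddMonoidAlgebra ℤ Γ))

/-- The basis element `e^γ` of `ℤ[Γ]`. -/
def expo (γ : Γ) : CoeffRing Γ := AddMonoidAlgebra.single (R := ℤ) γ 1

/-- The involution `∑ a_γ e^γ ↦ ∑ a_γ e^{-γ}` of `ℤ[Γ]`. -/
def barA : CoeffRing Γ →+* CoeffRing Γ :=
  AddMonoidAlgebra.mapDomainRingHom ℤ (-(AddMonoidHom.id Γ))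

/-- `a ∈ A_{<0}`: the element `a` is a `ℤ`-linear combination of the `e^γ` with `γ < 0`. -/
def IsNegA (a : CoeffRing Γ) : Prop :=
  ∀ γ ∈ (AddMonoidAlgebra.coeff (R := ℤ) a).support, γ < 0

/-! ### The Iwahori--Hecke algebra

The algebra is realized faithfully by its left multiplications on the free `A`-module with
basis `(e_w)`, where `e_w` stands for the basis element `T_w`. -/

/-- The free `A`-module with basis `(e_w)`. -/
def RegModule (G Γ : Type*) [AddCommGroup Γ] : Type _ := G →₀ CoeffRing Γ

instance : AddCommGroup (RegModule G Γ) := inferInstanceAs (AddCommGroup (G →₀ CoeffRing Γ))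

instance : Module (CoeffRing Γ) (RegModule G Γ) :=
  inferInstanceAs (Module (CoeffRing Γ) (G →₀ CoeffRing Γ))

/-- The basis element `e_w`. -/
def regBasis (w : G) : RegModule G Γ := Finsupp.single (M := CoeffRing Γ) w 1

/-- The operator `e_w ↦ e_{sw}` if `l(sw) > l(w)`, and
`e_w ↦ e_{sw} + (q_s - q_s⁻¹) e_w` otherwise, where `s = s i` and `q_s = e^{L(s)}`. -/
def leftMul (s : B → G) (L : G → Γ) (i : B) :
    Module.End (CoeffRing Γ) (RegModule G Γ) :=
  Finsupp.linearCombination (CoeffRing Γ) fun w : G =>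
    (if wordLength s w < wordLength s (s i * w) then
      regBasis (s i * w)
    else
      regBasis (s i * w) + (expo (L (s i)) - expo (-L (s i))) • regBasis w : RegModule G Γ)

/-- The generic Iwahori--Hecke algebra `H` over `A = ℤ[Γ]` with parameters `q_s = e^{L(s)}`. -/
def Hecke (s : B → G) (L : G → Γ) :
    Subalgebra (CoeffRing Γ)
      (Module.End (CoeffRing Γ) (RegModule G Γ)) :=
  Algebra.adjoin (CoeffRing Γ) (Set.range (leftMul s L))

/-- The generator `T_s` of the Iwahori--Hecke algebra, for `s = s i`. -/
def Tgen (s : B → G) (L : G → Γ) (i : B) : Hecke s L :=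
  ⟨leftMul s L i, Algebra.subset_adjoin ⟨i, rfl⟩⟩

/-- The element `T_w = T_{s_1} ⋯ T_{s_k}`, where `w = s_1 ⋯ s_k` is a reduced expression. -/
def T (s : B → G) (L : G → Γ) (w : G) : Hecke s L :=
  ((reducedWord s w).map (Tgen s L)).prod

/-- The coefficients of `h = ∑ a_w T_w` with respect to the basis `(T_w)`; they are read off
from `h e_1 = ∑ a_w e_w`, since `T_w e_1 = e_w`. -/
def coords (s : B → G) (L : G → Γ) (h : Hecke s L) : G →₀ CoeffRing Γ :=
  h.1 (regBasis 1)

/-- The bar involution `∑ a_w T_w ↦ ∑ \bar a_w T_{w⁻¹}⁻¹`. -/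
def barH (s : B → G) (L : G → Γ) (h : Hecke s L) : Hecke s L :=
  (coords s L h).sum fun w a => barA a • Ring.inverse (T s L w⁻¹)

/-- `c` has the defining properties of the Kazhdan--Lusztig basis element `C_w`:
it is bar invariant and congruent to `T_w` modulo `∑ A_{<0} T_y`. -/
def IsKL (s : B → G) (L : G → Γ) (w : G) (c : Hecke s L) : Prop :=
  barH s L c = c ∧ ∀ y, IsNegA (coords s L (c - T s L w) y)

/-- The Kazhdan--Lusztig basis element `C_w`, the unique element with the properties `IsKL`. -/
def KL (s : B → G) (L : G → Γ) (w : G) : Hecke s L :=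
  Classical.epsilon (IsKL s L w)

/-- The structure constants `h_{x,y,z} ∈ A`, given by `C_x C_y = ∑_z h_{x,y,z} C_z`. -/
def structConst (s : B → G) (L : G → Γ) (x y : G) : G →₀ CoeffRing Γ :=
  Classical.epsilon fun f =>
    KL s L x * KL s L y = Finsupp.linearCombination (CoeffRing Γ) (KL s L) f

/-! ### Left cells -/

/-- The Kazhdan--Lusztig left pre-order: `x ≤_L y` if there are `x = x_0, x_1, …, x_k = y` such
that for each `j` some `s = s i` satisfies `h_{s, x_j, x_{j-1}} ≠ 0`. -/
def LeftLE (s : B → G) (L : G → Γ) (x y : G) : Prop :=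
  Relation.ReflTransGen (fun a b => ∃ i, structConst s L (s i) b a ≠ 0) x y

/-- `C` is a left cell: an equivalence class of the relation `x ≤_L y ≤_L x`. -/
def IsLeftCell (s : B → G) (L : G → Γ) (C : Set G) : Prop :=
  ∃ x, C = {y | LeftLE s L y x ∧ LeftLE s L x y}

/-- `C` is a union of left cells. -/
def IsUnionOfLeftCells (s : B → G) (L : G → Γ) (C : Set G) : Prop :=
  ∃ 𝒮 : Set (Set G), (∀ D ∈ 𝒮, IsLeftCell s L D) ∧ C = ⋃₀ 𝒮

/-- The condition on a bijection `φ : C ≃ C₁`, written `x ↦ x₁`, that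
`h_{w,x,y} = h_{w,x₁,y₁}` for all `w ∈ G` and `x, y ∈ C`. -/
def Heart (s : B → G) (L : G → Γ) {C C₁ : Set G} (φ : C ≃ C₁) : Prop :=
  ∀ (w : G) (x y : C), structConst s L w x y = structConst s L w (φ x) (φ y)

/-- The relation `C ≈ C₁` between unions of left cells. -/
def CellApprox (s : B → G) (L : G → Γ) (C C₁ : Set G) : Prop :=
  IsUnionOfLeftCells s L C ∧ IsUnionOfLeftCells s L C₁ ∧ ∃ φ : C ≃ C₁, Heart s L φ

/-- The family `D` is a partition of `X` into left cells. -/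
def IsLeftCellPartition (s : B → G) (L : G → Γ) {ι : Type*} (X : Set G) (D : ι → Set G) : Prop :=
  (∀ α, IsLeftCell s L (D α)) ∧ Pairwise (fun α β => Disjoint (D α) (D β)) ∧ ⋃ α, D α = X

/-! ### Weight functions and parabolic subgroups -/

variable {M : CoxeterMatrix B}

/-- `L` is a weight function which is positive on the simple reflections. -/
def IsPosWeightFunction (cs : CoxeterSystem M G) (L : G → Γ) : Prop :=
  (∀ w w', cs.length (w * w') = cs.length w + cs.length w' → L (w * w') = L w + L w') ∧
    ∀ i, 0 < L (cs.simple i)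

/-- The standard parabolic subgroup `W_I` generated by the simple reflections in `I`. -/
def parabolic (cs : CoxeterSystem M G) (I : Set B) : Subgroup G :=
  Subgroup.closure (cs.simple '' I)

/-- The generators of `W_I`: the simple reflections in `I`. -/
def simpleI (cs : CoxeterSystem M G) (I : Set B) (i : I) : parabolic cs I :=
  ⟨cs.simple i, Subgroup.subset_closure ⟨i, i.2, rfl⟩⟩

/-- The restriction of `L` to `W_I`. -/
def weightI (cs : CoxeterSystem M G) (I : Set B) (L : G → Γ) (u : parabolic cs I) : Γ := L u

/-- The set `X_I` of distinguished left coset representatives: the elements `w` of minimal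
length in `w W_I`. -/
def leftReps (cs : CoxeterSystem M G) (I : Set B) : Set G :=
  {w | ∀ u ∈ parabolic cs I, cs.length w ≤ cs.length (w * u)}

/-- The set `X_I C = {x u ∣ x ∈ X_I, u ∈ C}` for `C ⊆ W_I`. -/
def induced (cs : CoxeterSystem M G) (I : Set B) (C : Set (parabolic cs I)) : Set G :=
  {w | ∃ x ∈ leftReps cs I, ∃ u ∈ C, w = x * u}

end KLCells

end

namespace KLCells

/-! ### The exchange condition, via an action of the Coxeter group on W × ℤ/2 -/

section Exchange

/-! Write H and H_I for the Hecke algebras of W and W_I. Both cells are treated at once, inside H_I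
× H_I with H_I acting diagonally. Take the pairs (C_u, C_{φ u}) for u in the cell, together with
(C_u, 0) and (0, C_u) for u strictly below the first, respectively the second, cell. By (♡) these
pairs span a left H_I-submodule: the coefficients inside the two cells agree, and everything else
lies strictly below them (`diag_mul_cellPair_mem`).

Induce to H: the elements T_z p, with z in X_I and p one of these pairs, span an H-submodule of H ×
H. The bar involution is unitriangular on them with respect to l(z). Indeed p is bar invariant, bar
T_z is T_z plus a combination of shorter T_w, and if w = xu with x in X_I and u in W_I, then T_u
preserves the span of the pairs while l(x) ≤ l(w) (`isUnitriangular_mixedPair`). The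
Kazhdan--Lusztig construction for a triangular involution (`IsUnitriangular.exists_invariant`)
therefore gives a bar invariant element congruent to T_z p modulo coefficients in A_{<0}. Each of
its components is bar invariant and congruent to some T_{zu} or to 0, so by uniqueness it is C_{zu}
or 0. Thus the pairs (C_{zu}, C_{zφ(u)}), (C_{zu}, 0) and (0, C_{zu}) span an H-submodule
(`isUnitriangular_inducedPair`, `diag_mul_inducedPair_mem`).

Multiply (C_{xu}, C_{xφ(u)}) by C_w. On each spanning pair, the coefficient at zv in the first
component equals the coefficient at zφ(v) in the second; hence so it does on the product, which is
(♡) for W. The same submodule with φ the identity shows that zv ≤ xu in W implies v ≤ u in W_I, so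
the induced sets are unions of left cells. Finally, (♡) transports chains inside a left cell, so it
matches left cells with left cells.

The foundations are the exchange condition, the commutation of left and right multiplication
operators (which gives the basis T_w), and the Kazhdan--Lusztig basis. They are developed for
`IsCoxeterWeight`, so that they apply to both W and W_I. -/

theorem dihedral_mul_pow {W : Type*} [Group W] {a b : W} (ha : a⁻¹ = a) (hb : b⁻¹ = b) (n : ℕ) :
    b * (a * b) ^ n = ((a * b) ^ n)⁻¹ * b := by
  induction n with
  | zero => simp
  | succ n ih =>
    rw [pow_succ, ← mul_assoc, ih, ← pow_succ, pow_succ', mul_inv_rev, mul_inv_rev, ha, hb]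
    simp only [mul_assoc]

/-- Conjugation by b inverts ab, so pulling b back through (ab)^p produces (ab)^(-2p) b. This and
its odd companion show that the reflections met along a power of ab are the (ab)^(-n) b, one for
each n. -/
theorem dihedral_conj_iff {W : Type*} [Group W] {a b t : W} (ha : a⁻¹ = a) (hb : b⁻¹ = b)
    (p : ℕ) : (a * b) ^ p * t * ((a * b) ^ p)⁻¹ = b ↔ t = ((a * b) ^ (2 * p))⁻¹ * b := by
  rw [two_mul, pow_add, mul_inv_rev, mul_assoc _ _ b, ← dihedral_mul_pow ha hb,
    mul_inv_eq_iff_eq_mul, eq_inv_mul_iff_mul_eq]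

theorem dihedral_conj_iff' {W : Type*} [Group W] {a b t : W} (ha : a⁻¹ = a) (hb : b⁻¹ = b)
    (p : ℕ) : b * ((a * b) ^ p * t * ((a * b) ^ p)⁻¹) * b = a ↔
      t = ((a * b) ^ (2 * p + 1))⁻¹ * b := by
  have h1 : ∀ X : W, b * X * b = a ↔ X = (a * b)⁻¹ * b := by
    intro X
    rw [mul_assoc, ← eq_inv_mul_iff_mul_eq, ← eq_mul_inv_iff_mul_eq, mul_inv_rev, hb, ha]
  rw [h1, mul_inv_eq_iff_eq_mul, mul_assoc, dihedral_mul_pow ha hb, ← eq_inv_mul_iff_mul_eq,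
    show 2 * p + 1 = p + (1 + p) by ring, pow_add, pow_add, pow_one, mul_inv_rev]
  simp only [mul_assoc, mul_inv_rev]

variable {B W : Type*} [Group W] {M : CoxeterMatrix B} (cs : CoxeterSystem M W)

open Classical in
/-- The generator `(t, e) ↦ (s t s, e + [t = s])` of the action of `W` on `W × ℤ/2`. -/
noncomputable def reflAct (i : B) : Function.End (W × ZMod 2) := fun p =>
  (cs.simple i * p.1 * cs.simple i, p.2 + if p.1 = cs.simple i then 1 else 0)

open Classical in
theorem reflAct_mul_pow (i j : B) (p : ℕ) (t : W) (e : ZMod 2) :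
    ((reflAct cs i * reflAct cs j) ^ p : Function.End (W × ZMod 2)) (t, e) =
      ((cs.simple i * cs.simple j) ^ p * t * ((cs.simple i * cs.simple j) ^ p)⁻¹,
        e + ∑ n ∈ Finset.range (2 * p),
          if t = ((cs.simple i * cs.simple j) ^ n)⁻¹ * cs.simple j then 1 else 0) := by
  induction p with
  | zero => simp; rfl
  | succ p ih =>
    rw [pow_succ']
    change (reflAct cs i * reflAct cs j)
      (((reflAct cs i * reflAct cs j) ^ p : Function.End (W × ZMod 2)) (t, e)) = _
    rw [ih]
    change reflAct cs i (reflAct cs j _) = _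
    have hi := cs.inv_simple i
    have hj := cs.inv_simple j
    simp only [reflAct]
    rw [show 2 * (p + 1) = 2 * p + 1 + 1 by ring, Finset.sum_range_succ, Finset.sum_range_succ]
    refine Prod.ext ?_ ?_
    · simp only [pow_succ', mul_inv_rev, hi, hj, mul_assoc]
    · simp only [dihedral_conj_iff hi hj, dihedral_conj_iff' hi hj, add_assoc]

/-- With m the order attached to i and j, the sum over n < 2m consists of two equal halves because
(s_i s_j)^m = 1. It vanishes in ℤ/2. -/
theorem reflAct_isLiftable : M.IsLiftable (reflAct cs) := by
  classical
  intro i j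
  funext ⟨t, e⟩
  rw [reflAct_mul_pow, cs.simple_mul_simple_pow]
  refine Prod.ext (by simp; rfl) ?_
  rw [two_mul, Finset.sum_range_add]
  simp only [pow_add, cs.simple_mul_simple_pow, one_mul]
  exact (congrArg (e + ·) (CharTwo.add_self_eq_zero _)).trans (add_zero e)

open Classical in
theorem reflAct_word (ω : List B) (t : W) (e : ZMod 2) :
    ((ω.map (reflAct cs)).prod : Function.End (W × ZMod 2)) (t, e) =
      (cs.wordProd ω * t * (cs.wordProd ω)⁻¹, e + ((cs.rightInvSeq ω).count t : ZMod 2)) := by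
  induction ω with
  | nil => simp; rfl
  | cons i ω ih =>
    rw [List.map_cons, List.prod_cons]
    change reflAct cs i (((ω.map (reflAct cs)).prod : Function.End (W × ZMod 2)) (t, e)) = _
    rw [ih]
    simp only [reflAct, CoxeterSystem.rightInvSeq, cs.wordProd_cons, List.count_cons]
    refine Prod.ext ?_ ?_
    · simp [mul_assoc]
    · have : ((cs.wordProd ω)⁻¹ * cs.simple i * cs.wordProd ω == t) = true ↔
          cs.wordProd ω * t * (cs.wordProd ω)⁻¹ = cs.simple i := by
        rw [beq_iff_eq, mul_inv_eq_iff_eq_mul, mul_assoc, inv_mul_eq_iff_eq_mul, eq_comm]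
      simp only [this]
      push_cast
      rw [add_assoc]

open Classical in
-- The parity is the second component of the action on (t, 0). The action factors through W, so it
-- sees only the product of the word.
theorem count_rightInvSeq_congr {ω ω' : List B} (h : cs.wordProd ω = cs.wordProd ω') (t : W) :
    ((cs.rightInvSeq ω).count t : ZMod 2) = (cs.rightInvSeq ω').count t := by
  have key : ∀ ω : List B, (ω.map (reflAct cs)).prod =
      cs.lift ⟨reflAct cs, reflAct_isLiftable cs⟩ (cs.wordProd ω) := by
    intro ω
    rw [CoxeterSystem.wordProd, map_list_prod, List.map_map]
    congr 2
    ext1 i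
    exact (cs.lift_apply_simple (reflAct_isLiftable cs) i).symm
  have h1 := congrFun ((key ω).trans ((congrArg _ h).trans (key ω').symm)) (t, 0)
  rw [reflAct_word, reflAct_word] at h1
  simpa using congrArg Prod.snd h1

/-- The exchange condition. -/
theorem exchange_right {ω : List B} {j : B}
    (hj : cs.length (cs.wordProd ω * cs.simple j) < cs.length (cs.wordProd ω)) :
    ∃ k < ω.length, cs.wordProd ω * cs.simple j = cs.wordProd (ω.eraseIdx k) := by
  classical
  obtain ⟨ω', hω', h⟩ := cs.exists_isReduced (cs.wordProd ω * cs.simple j)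
  -- Appending j to a reduced word of w s_j gives a reduced word of w. Its inversion sequence
  -- contains s_j exactly once, so by parity s_j also occurs in that of ω, at the position to be
  -- deleted.
  have hw : cs.wordProd ω = cs.wordProd (ω'.concat j) := by
    rw [cs.wordProd_concat, ← h, cs.simple_mul_simple_cancel_right]
  have hred : cs.IsReduced (ω'.concat j) := by
    unfold CoxeterSystem.IsReduced
    rw [← hw, List.length_concat, ← hω'.eq, ← h]
    rcases cs.length_mul_simple (cs.wordProd ω) j with h1 | h1 <;> omega
  have hmem : cs.simple j ∈ cs.rightInvSeq (ω'.concat j) := by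
    rw [cs.rightInvSeq_concat]; simp
  have h1 := count_rightInvSeq_congr cs hw (cs.simple j)
  rw [List.count_eq_one_of_mem hred.nodup_rightInvSeq hmem] at h1
  have hmem' : cs.simple j ∈ cs.rightInvSeq ω := by
    rw [← List.count_pos_iff]
    by_contra h0
    rw [show (cs.rightInvSeq ω).count (cs.simple j) = 0 by omega] at h1
    exact absurd h1 (by decide)
  obtain ⟨k, hk, hk'⟩ := List.getElem_of_mem hmem'
  refine ⟨k, by simpa using hk, ?_⟩
  rw [← cs.wordProd_mul_getD_rightInvSeq, List.getD_eq_getElem _ _ hk, hk']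

/-- Exchange in the word i ω must delete the letter i: deleting a letter of ω would make w s_j no
longer than w. -/
theorem length_simple_mul_simple_fold {w : W} {i j : B}
    (h1 : cs.length w < cs.length (cs.simple i * w))
    (h2 : cs.length w < cs.length (w * cs.simple j))
    (h3 : cs.length (cs.simple i * w * cs.simple j) < cs.length (cs.simple i * w)) :
    cs.simple i * w = w * cs.simple j := by
  obtain ⟨ω, hω, rfl⟩ := cs.exists_isReduced w
  rw [← cs.wordProd_cons] at h3
  obtain ⟨k, hk, e⟩ := exchange_right cs h3
  rw [cs.wordProd_cons] at e
  cases k with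
  | zero =>
    rw [List.eraseIdx_cons_zero] at e
    rw [← e, cs.simple_mul_simple_cancel_right, e]
  | succ k =>
    rw [List.eraseIdx_cons_succ, cs.wordProd_cons, mul_assoc, mul_left_cancel_iff] at e
    have h4 := cs.length_wordProd_le (ω.eraseIdx k)
    rw [← e] at h4
    have h5 := hω.eq
    have h6 := List.length_eraseIdx_le ω k
    omega

end Exchange

/-- The properties of a Coxeter group with a positive weight function that enter the theory of
its Iwahori--Hecke algebra. -/
structure IsCoxeterWeight {B G Γ : Type*} [Group G] [AddCommGroup Γ] [LinearOrder Γ]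
    (s : B → G) (L : G → Γ) : Prop where
  sq : ∀ i, s i * s i = 1
  exists_word : ∀ w, ∃ ω : List B, (ω.map s).prod = w
  length_ne : ∀ i w, wordLength s (s i * w) ≠ wordLength s w
  fold : ∀ i j w, wordLength s w < wordLength s (s i * w) →
    wordLength s w < wordLength s (w * s j) →
    wordLength s (s i * w * s j) < wordLength s (s i * w) → s i * w = w * s j
  weight_mul : ∀ w w', wordLength s (w * w') = wordLength s w + wordLength s w' →
    L (w * w') = L w + L w'
  weight_pos : ∀ i, 0 < L (s i)

theorem isCoxeterWeight_simple {B W Γ : Type*} [Group W] [AddCommGroup Γ] [LinearOrder Γ]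
    {M : CoxeterMatrix B} (cs : CoxeterSystem M W) {L : W → Γ} (hL : IsPosWeightFunction cs L) :
    IsCoxeterWeight cs.simple L where
  sq := cs.simple_mul_simple_self
  exists_word w := by
    obtain ⟨ω, -, h⟩ := cs.exists_isReduced w
    exact ⟨ω, h.symm⟩
  length_ne i w := by
    simpa only [wordLength_simple] using cs.length_simple_mul_ne w i
  fold i j w := by
    simpa only [wordLength_simple] using length_simple_mul_simple_fold cs
  weight_mul w w' := by
    simpa only [wordLength_simple] using hL.1 w w'
  weight_pos := hL.2

/-! ### Parabolic subgroups and distinguished coset representatives -/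

section Parabolic

variable {B W : Type*} [Group W] {M : CoxeterMatrix B} (cs : CoxeterSystem M W) (I : Set B)

theorem coe_prod_simpleI (ω : List I) :
    (((ω.map (simpleI cs I)).prod : parabolic cs I) : W) =
      cs.wordProd (ω.map Subtype.val) := by
  rw [← Subgroup.coe_subtype, map_list_prod, List.map_map, CoxeterSystem.wordProd, List.map_map]
  rfl

theorem simpleI_mul_self (i : I) : simpleI cs I i * simpleI cs I i = 1 :=
  Subtype.ext (cs.simple_mul_simple_self _)

theorem exists_wordI (u : parabolic cs I) :
    ∃ ω : List I, (ω.map (simpleI cs I)).prod = u := by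
  obtain ⟨u, hu⟩ := u
  unfold parabolic at hu
  induction hu using Subgroup.closure_induction with
  | mem x hx =>
    obtain ⟨i, hi, rfl⟩ := hx
    exact ⟨[⟨i, hi⟩], by simp [simpleI]⟩
  | one => exact ⟨[], rfl⟩
  | mul x y hx hy h1 h2 =>
    obtain ⟨ω, h1⟩ := h1
    obtain ⟨ω', h2⟩ := h2
    refine ⟨ω ++ ω', ?_⟩
    rw [List.map_append, List.prod_append, h1, h2]
    rfl
  | inv x hx h =>
    obtain ⟨ω, h⟩ := h
    refine ⟨ω.reverse, ?_⟩
    apply Subtype.ext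
    have h' := congrArg (Subtype.val) h
    rw [coe_prod_simpleI] at h' ⊢
    rw [List.map_reverse, cs.wordProd_reverse, h']

/-- Every element of `W_I` has a reduced expression with letters in `I`. -/
theorem exists_isReducedI (u : parabolic cs I) :
    ∃ ω : List I, (ω.map (simpleI cs I)).prod = u ∧ cs.length u = ω.length := by
  obtain ⟨ω, rfl⟩ := exists_wordI cs I u
  induction ω using List.reverseRecOn with
  | nil => exact ⟨[], rfl, by simp⟩
  | append_singleton ω i ih =>
    obtain ⟨ω', h1, h2⟩ := ih
    rw [← h1, coe_prod_simpleI] at h2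
    rw [List.map_append, List.prod_append, ← h1]
    have e1 : (((ω'.map (simpleI cs I)).prod * ([i].map (simpleI cs I)).prod : parabolic cs I) : W)
        = cs.wordProd (ω'.map Subtype.val) * cs.simple i := by
      rw [Subgroup.coe_mul, coe_prod_simpleI]; simp [simpleI]
    rcases cs.length_mul_simple (cs.wordProd (ω'.map Subtype.val)) i with h3 | h3
    · refine ⟨ω' ++ [i], by simp, ?_⟩
      rw [e1, h3, h2]; simp
    -- Exchange only deletes a letter, so the shorter word still has its letters in I.
    · obtain ⟨k, hk, e⟩ := exchange_right cs (ω := ω'.map Subtype.val) (j := i) (by omega)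
      rw [List.eraseIdx_map] at e
      refine ⟨ω'.eraseIdx k, ?_, ?_⟩
      · apply Subtype.ext
        rw [coe_prod_simpleI, e1, e]
      · rw [e1, List.length_eraseIdx_of_lt (by simpa using hk)]
        omega

/-- Through this equality the length conditions of `IsCoxeterWeight` pass from W to W_I. -/
theorem wordLength_simpleI (u : parabolic cs I) :
    wordLength (simpleI cs I) u = cs.length u := by
  obtain ⟨ω, hω, h⟩ := exists_isReducedI cs I u
  apply le_antisymm
  · exact Nat.sInf_le ⟨ω, h.symm, hω⟩
  · have hne : {n | ∃ ω : List I, ω.length = n ∧ (ω.map (simpleI cs I)).prod = u}.Nonempty :=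
      ⟨_, ω, rfl, hω⟩
    obtain ⟨ω', h1, h2⟩ := Nat.sInf_mem hne
    calc cs.length u = cs.length (cs.wordProd (ω'.map Subtype.val)) := by
          rw [← coe_prod_simpleI, h2]
      _ ≤ (ω'.map Subtype.val).length := cs.length_wordProd_le _
      _ = ω'.length := List.length_map _
      _ = _ := h1

theorem isCoxeterWeight_simpleI {Γ : Type*} [AddCommGroup Γ] [LinearOrder Γ] {L : W → Γ}
    (hL : IsPosWeightFunction cs L) :
    IsCoxeterWeight (simpleI cs I) (weightI cs I L) where
  sq := simpleI_mul_self cs I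
  exists_word := exists_wordI cs I
  length_ne i w := by
    simp only [wordLength_simpleI]
    exact cs.length_simple_mul_ne w i
  fold i j w h1 h2 h3 := by
    simp only [wordLength_simpleI] at h1 h2 h3
    exact Subtype.ext (length_simple_mul_simple_fold cs h1 h2 h3)
  weight_mul w w' h := by
    simp only [wordLength_simpleI] at h
    exact hL.1 _ _ h
  weight_pos i := hL.2 i

variable {I}

/-- Append the letters of a reduced word of u one by one. If the length dropped, exchange would
delete either a letter of x, giving a shorter element of x W_I, or a letter of the word of u,
contradicting its reducedness. -/
theorem length_leftReps_mul {x : W} (hx : x ∈ leftReps cs I) (u : parabolic cs I) :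
    cs.length (x * u) = cs.length x + cs.length u := by
  obtain ⟨ω, rfl, h⟩ := exists_isReducedI cs I u
  rw [coe_prod_simpleI] at h ⊢
  rw [h]
  induction ω using List.reverseRecOn with
  | nil => simp
  | append_singleton ω i ih =>
    have h0 := cs.length_wordProd_le (ω.map Subtype.val)
    have h1 : cs.length (cs.wordProd (ω.map Subtype.val)) = ω.length := by
      have h2 := cs.length_mul_le (cs.wordProd (ω.map Subtype.val)) (cs.simple i)
      rw [List.map_append, cs.wordProd_append] at h
      simp only [List.map_cons, List.map_nil, cs.wordProd_singleton, List.length_append,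
        List.length_singleton] at h
      rw [h, cs.length_simple] at h2
      rw [List.length_map] at h0
      omega
    have ih := ih h1
    have e1 : x * cs.wordProd ((ω ++ [i]).map Subtype.val) =
        x * cs.wordProd (ω.map Subtype.val) * cs.simple i := by
      simp [cs.wordProd_append, mul_assoc]
    rw [e1, List.length_append, List.length_singleton]
    rcases cs.length_mul_simple (x * cs.wordProd (ω.map Subtype.val)) i with h3 | h3
    · omega
    · exfalso
      obtain ⟨ξ, hξ, rfl⟩ := cs.exists_isReduced x
      rw [← cs.wordProd_append] at h3 ih
      obtain ⟨k, hk, e⟩ := exchange_right cs (ω := ξ ++ ω.map Subtype.val) (j := i) (by omega)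
      by_cases hkξ : k < ξ.length
      · rw [List.eraseIdx_append_of_lt_length hkξ, cs.wordProd_append, cs.wordProd_append] at e
        have h4 := hx (((ω ++ [i]) ++ ω.reverse).map (simpleI cs I)).prod (Subtype.property _)
        rw [coe_prod_simpleI, List.map_append, cs.wordProd_append, ← mul_assoc, e1, e,
          List.map_reverse, cs.wordProd_reverse, mul_inv_cancel_right, hξ.eq] at h4
        have h5 := cs.length_wordProd_le (ξ.eraseIdx k)
        rw [List.length_eraseIdx_of_lt hkξ] at h5
        omega
      · rw [List.eraseIdx_append_of_length_le (not_lt.mp hkξ), cs.wordProd_append,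
          cs.wordProd_append, mul_assoc, mul_left_cancel_iff] at e
        have e2 : cs.wordProd ((ω ++ [i]).map Subtype.val) =
          cs.wordProd (ω.map Subtype.val) * cs.simple i := by simp [cs.wordProd_append]
        rw [e2, e] at h
        have h5 := cs.length_wordProd_le ((ω.map Subtype.val).eraseIdx (k - ξ.length))
        have h6 := List.length_eraseIdx_le (ω.map Subtype.val) (k - ξ.length)
        rw [h] at h5
        simp at h5 h6
        omega

/-- Put v = u u'⁻¹. Additivity of lengths, applied to x' = x v and to x = x' v⁻¹, forces l(v) = 0.
-/
theorem leftReps_mul_injective {x x' : W} (hx : x ∈ leftReps cs I) (hx' : x' ∈ leftReps cs I)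
    {u u' : parabolic cs I} (h : x * u = x' * u') : x = x' ∧ u = u' := by
  have e : x' = x * (u * u'⁻¹ : parabolic cs I) := by
    rw [Subgroup.coe_mul, ← mul_assoc, h]; simp
  have h1 := length_leftReps_mul cs hx (u * u'⁻¹)
  have e' : x = x' * ((u * u'⁻¹)⁻¹ : parabolic cs I) := by
    rw [e, mul_assoc, ← Subgroup.coe_mul, mul_inv_cancel, Subgroup.coe_one, mul_one]
  have h2 := length_leftReps_mul cs hx' (u * u'⁻¹)⁻¹
  rw [← e] at h1
  rw [← e'] at h2
  have h3 : cs.length ((u * u'⁻¹ : parabolic cs I) : W) = 0 := by omega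
  rw [cs.length_eq_zero_iff] at h3
  have h4 : u * u'⁻¹ = 1 := Subtype.ext h3
  refine ⟨?_, mul_inv_eq_one.mp h4⟩
  rw [e, h3, mul_one]

variable (I) in
theorem exists_leftReps_mul (w : W) :
    ∃ x ∈ leftReps cs I, ∃ u : parabolic cs I, w = x * u := by
  obtain ⟨u, hu⟩ : ∃ u : parabolic cs I, ∀ v : parabolic cs I,
      cs.length (w * u) ≤ cs.length (w * v) := by
    have := WellFounded.has_min
      (measure fun u : parabolic cs I => cs.length (w * u)).wf Set.univ ⟨1, trivial⟩
    obtain ⟨u, -, hu⟩ := this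
    exact ⟨u, fun v => not_lt.mp (hu v trivial)⟩
  refine ⟨w * u, fun v hv => ?_, u⁻¹, by simp⟩
  have := hu (u * ⟨v, hv⟩)
  simpa [mul_assoc] using this

variable (I) in
/-- The bijection `X_I × W_I → W`, `(x, u) ↦ xu`. -/
noncomputable def cosetEquiv : leftReps cs I × parabolic cs I ≃ W :=
  Equiv.ofBijective (fun p => (p.1 : W) * p.2)
    ⟨fun p q h => by
      obtain ⟨h1, h2⟩ := leftReps_mul_injective cs p.1.2 q.1.2 h
      exact Prod.ext (Subtype.ext h1) h2,
    fun w => by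
      obtain ⟨x, hx, u, rfl⟩ := exists_leftReps_mul cs I w
      exact ⟨(⟨x, hx⟩, u), rfl⟩⟩

end Parabolic

end KLCells

namespace KLCells

/-! ### Left and right multiplication operators on the regular module -/

section RegularModule

variable {B G Γ : Type*}

section

variable [Group G]

theorem wordLength_le (s : B → G) (ω : List B) : wordLength s (ω.map s).prod ≤ ω.length :=
  Nat.sInf_le ⟨ω, rfl, rfl⟩

theorem wordLength_one (s : B → G) : wordLength s 1 = 0 :=
  Nat.le_zero.mp (wordLength_le s [])

theorem wordLength_simple_le (s : B → G) (i : B) : wordLength s (s i) ≤ 1 := by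
  simpa using wordLength_le s [i]

end

variable [AddCommGroup Γ]

/-- The basis `(e_w)`. -/
noncomputable def regB (G Γ : Type*) [AddCommGroup Γ] :
    Module.Basis G (CoeffRing Γ) (RegModule G Γ) :=
  Module.Basis.ofRepr (LinearEquiv.refl (CoeffRing Γ) (G →₀ CoeffRing Γ))

theorem regB_apply (w : G) : regB G Γ w = regBasis w := rfl

variable [Group G] {s : B → G} {L : G → Γ}

/-- The element `q_s - q_s⁻¹`. -/
noncomputable def xi (s : B → G) (L : G → Γ) (i : B) : CoeffRing Γ :=
  expo (L (s i)) - expo (-L (s i))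

open Classical in
theorem leftMul_regBasis (i : B) (w : G) :
    leftMul s L i (regBasis w) = if wordLength s w < wordLength s (s i * w) then
      regBasis (s i * w) else regBasis (s i * w) + xi s L i • regBasis w := by
  unfold leftMul regBasis
  refine (Finsupp.linearCombination_single _ _ _).trans ?_
  rw [one_smul]
  congr

open Classical in
/-- The operator of right multiplication by `T_s`. -/
noncomputable def rightMul (s : B → G) (L : G → Γ) (i : B) :
    Module.End (CoeffRing Γ) (RegModule G Γ) :=
  (regB G Γ).constr (CoeffRing Γ) fun w =>
    if wordLength s w < wordLength s (w * s i) then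
      regBasis (w * s i) else regBasis (w * s i) + xi s L i • regBasis w

open Classical in
theorem rightMul_regBasis (i : B) (w : G) :
    rightMul s L i (regBasis w) = if wordLength s w < wordLength s (w * s i) then
      regBasis (w * s i) else regBasis (w * s i) + xi s L i • regBasis w :=
  (regB G Γ).constr_basis _ _ _

/-- The linear map `h ↦ h e_1`. -/
noncomputable def coordsL (s : B → G) (L : G → Γ) :
    Hecke s L →ₗ[CoeffRing Γ] RegModule G Γ :=
  (LinearMap.applyₗ (regBasis 1)).comp (Hecke s L).val.toLinearMap

theorem coordsL_Tgen_mul (i : B) (a : Hecke s L) :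
    coordsL s L (Tgen s L i * a) = leftMul s L i (coordsL s L a) := rfl

end RegularModule

variable {B G Γ : Type*} [Group G] [AddCommGroup Γ] [LinearOrder Γ] {s : B → G} {L : G → Γ}

/-! ### Lengths, and the standard basis of the Iwahori--Hecke algebra -/

namespace IsCoxeterWeight

theorem exists_reduced (h : IsCoxeterWeight s L) (w : G) : ∃ ω, IsReducedWord s w ω := by
  have hne : {n | ∃ ω : List B, ω.length = n ∧ (ω.map s).prod = w}.Nonempty := by
    obtain ⟨ω, hω⟩ := h.exists_word w
    exact ⟨_, ω, rfl, hω⟩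
  obtain ⟨ω, h1, h2⟩ := Nat.sInf_mem hne
  exact ⟨ω, h2, h1⟩

theorem isReducedWord_reducedWord (h : IsCoxeterWeight s L) (w : G) :
    IsReducedWord s w (reducedWord s w) :=
  Classical.epsilon_spec (h.exists_reduced w)

theorem inv_simple (h : IsCoxeterWeight s L) (i : B) : (s i)⁻¹ = s i :=
  inv_eq_of_mul_eq_one_left (h.sq i)

theorem simple_mul_cancel (h : IsCoxeterWeight s L) (i : B) (w : G) : s i * (s i * w) = w := by
  rw [← mul_assoc, h.sq, one_mul]

theorem mul_simple_cancel (h : IsCoxeterWeight s L) (i : B) (w : G) : w * s i * s i = w := by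
  rw [mul_assoc, h.sq, mul_one]

theorem eq_one_of_wordLength (h : IsCoxeterWeight s L) {w : G} (hw : wordLength s w = 0) :
    w = 1 := by
  obtain ⟨ω, h1, h2⟩ := h.exists_reduced w
  rw [hw, List.length_eq_zero_iff] at h2
  rw [← h1, h2]; rfl

theorem wordLength_mul_le (h : IsCoxeterWeight s L) (w w' : G) :
    wordLength s (w * w') ≤ wordLength s w + wordLength s w' := by
  obtain ⟨ω, h1, h2⟩ := h.exists_reduced w
  obtain ⟨ω', h3, h4⟩ := h.exists_reduced w'
  rw [← h2, ← h4, ← List.length_append, ← h1, ← h3, ← List.prod_append, ← List.map_append]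
  exact wordLength_le s _

theorem wordLength_inv_le (h : IsCoxeterWeight s L) (w : G) :
    wordLength s w⁻¹ ≤ wordLength s w := by
  obtain ⟨ω, h1, h2⟩ := h.exists_reduced w
  have : w⁻¹ = (ω.reverse.map s).prod := by
    rw [← h1, List.prod_inv_reverse, List.map_reverse, List.map_map]
    congr 3
    funext i
    exact h.inv_simple i
  rw [← h2, this, ← List.length_reverse]
  exact wordLength_le s _

theorem wordLength_inv (h : IsCoxeterWeight s L) (w : G) : wordLength s w⁻¹ = wordLength s w :=
  le_antisymm (h.wordLength_inv_le w) (by simpa using h.wordLength_inv_le w⁻¹)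

theorem wordLength_simple_mul (h : IsCoxeterWeight s L) (i : B) (w : G) :
    wordLength s (s i * w) = wordLength s w + 1 ∨ wordLength s (s i * w) + 1 = wordLength s w := by
  have h1 := h.wordLength_mul_le (s i) w
  have h2 := h.wordLength_mul_le (s i) (s i * w)
  rw [h.simple_mul_cancel] at h2
  have h3 := wordLength_simple_le s i
  have h4 := h.length_ne i w
  omega

theorem wordLength_mul_simple (h : IsCoxeterWeight s L) (i : B) (w : G) :
    wordLength s (w * s i) = wordLength s w + 1 ∨ wordLength s (w * s i) + 1 = wordLength s w := by
  have := h.wordLength_simple_mul i w⁻¹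
  rwa [← h.inv_simple, ← mul_inv_rev, h.wordLength_inv, h.wordLength_inv] at this

theorem wordLength_simple (h : IsCoxeterWeight s L) (i : B) : wordLength s (s i) = 1 := by
  have := h.wordLength_simple_mul i 1
  rw [mul_one, wordLength_one] at this
  omega

theorem exists_left_descent (h : IsCoxeterWeight s L) {w : G} (hw : w ≠ 1) :
    ∃ i, wordLength s (s i * w) + 1 = wordLength s w := by
  obtain ⟨ω, h1, h2⟩ := h.exists_reduced w
  cases ω with
  | nil => exact absurd h1.symm hw
  | cons i ω =>
    refine ⟨i, (h.wordLength_simple_mul i w).resolve_left fun h3 => ?_⟩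
    rw [List.map_cons, List.prod_cons] at h1
    have h4 := wordLength_le s ω
    rw [← h2, ← h1, h.simple_mul_cancel, List.length_cons] at h3
    omega

theorem left_induction (h : IsCoxeterWeight s L) {P : G → Prop} (one : P 1)
    (mul : ∀ i w, wordLength s w < wordLength s (s i * w) → P w → P (s i * w)) (w : G) : P w := by
  induction hn : wordLength s w generalizing w with
  | zero => rwa [h.eq_one_of_wordLength hn]
  | succ n ih =>
    have hw : w ≠ 1 := by
      rintro rfl
      rw [wordLength_one] at hn
      omega
    obtain ⟨i, hi⟩ := h.exists_left_descent hw
    have := mul i (s i * w) (by rw [h.simple_mul_cancel]; omega) (ih _ (by omega))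
    rwa [h.simple_mul_cancel] at this

theorem right_induction (h : IsCoxeterWeight s L) {P : G → Prop} (one : P 1)
    (mul : ∀ i w, wordLength s w < wordLength s (w * s i) → P w → P (w * s i)) (w : G) : P w := by
  have := h.left_induction (P := fun w => P w⁻¹) (by simpa using one) (fun i w hw hP => by
    rw [mul_inv_rev, h.inv_simple]
    refine mul i _ ?_ hP
    rw [← h.inv_simple, ← mul_inv_rev, h.wordLength_inv, h.wordLength_inv]
    exact hw) w⁻¹
  simpa using this

/-- If `sw = wt` for simple reflections `s`, `t`, then `L(s) = L(t)`. -/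
theorem weight_eq (h : IsCoxeterWeight s L) {i j : B} {w : G} (e : s i * w = w * s j) :
    L (s i) = L (s j) := by
  have key : ∀ w : G, wordLength s w < wordLength s (s i * w) → s i * w = w * s j →
      L (s i) = L (s j) := by
    intro w hw e
    have h1 := h.weight_mul (s i) w (by
      rw [h.wordLength_simple]; rcases h.wordLength_simple_mul i w with h1 | h1 <;> omega)
    have h2 := h.weight_mul w (s j) (by
      rw [h.wordLength_simple, ← e]; rcases h.wordLength_simple_mul i w with h1 | h1 <;> omega)
    rw [e, h2, add_comm] at h1
    exact (add_right_cancel h1).symm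
  rcases h.wordLength_simple_mul i w with h1 | h1
  · exact key w (by omega) e
  · refine key (s i * w) (by rw [h.simple_mul_cancel]; omega) ?_
    rw [h.simple_mul_cancel, e, h.mul_simple_cancel]

/-- Compare lengths of w, s w, w s' and s w s'. Of the eight sign patterns two are impossible and
four are direct. In the other two `fold` gives s w = w s', and the correction terms agree because
L(s) = L(s'). -/
theorem leftMul_rightMul_comm (h : IsCoxeterWeight s L) (i j : B) :
    leftMul s L i * rightMul s L j = rightMul s L j * leftMul s L i := by
  refine (regB G Γ).ext fun w => ?_
  rw [regB_apply, Module.End.mul_apply, Module.End.mul_apply, rightMul_regBasis, leftMul_regBasis]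
  have e0 := mul_assoc (s i) w (s j)
  have hxi : s i * w = w * s j → xi s L i = xi s L j := fun e => by
    unfold xi; rw [h.weight_eq e]
  rcases h.wordLength_simple_mul i w with h1 | h1 <;>
  rcases h.wordLength_mul_simple j w with h2 | h2 <;>
  rcases h.wordLength_mul_simple j (s i * w) with h3 | h3
  · rw [if_pos (by omega), if_pos (by omega), rightMul_regBasis, leftMul_regBasis, ← e0,
      if_pos (by omega), if_pos (by omega)]
  · have e := h.fold i j w (by omega) (by omega) (by omega)
    rw [if_pos (by omega), if_pos (by omega), rightMul_regBasis, leftMul_regBasis, ← e0,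
      if_neg (by omega), if_neg (by omega), ← e, hxi e]
  · exfalso
    have := h.wordLength_simple_mul i (w * s j)
    rw [← e0] at this
    omega
  · rw [if_neg (by omega), if_pos (by omega), rightMul_regBasis, map_add, map_smul,
      leftMul_regBasis, leftMul_regBasis, ← e0, if_pos (by omega), if_pos (by omega),
      if_neg (by omega)]
  · rw [if_pos (by omega), if_neg (by omega), leftMul_regBasis, map_add, map_smul,
      rightMul_regBasis, rightMul_regBasis, ← e0, if_neg (by omega), if_pos (by omega),
      if_pos (by omega)]
  · exfalso
    have := h.wordLength_simple_mul i (w * s j)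
    rw [← e0] at this
    omega
  · have e := h.fold i j (s i * w) (by rw [h.simple_mul_cancel]; omega) (by omega)
      (by rw [h.simple_mul_cancel]; omega)
    have e' : s i * w = w * s j := by
      rw [h.simple_mul_cancel, mul_assoc] at e
      rw [e, h.simple_mul_cancel, ← e]
    rw [if_neg (by omega), if_neg (by omega), map_add, map_smul, map_add, map_smul,
      leftMul_regBasis, rightMul_regBasis, rightMul_regBasis, leftMul_regBasis, ← e0,
      if_pos (by omega), if_neg (by omega), if_pos (by omega), if_neg (by omega), ← e', hxi e']
  · rw [if_neg (by omega), if_neg (by omega), map_add, map_smul, map_add, map_smul,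
      leftMul_regBasis, rightMul_regBasis, rightMul_regBasis, leftMul_regBasis, ← e0,
      if_neg (by omega), if_neg (by omega), if_neg (by omega), if_neg (by omega)]
    module

theorem commute_rightMul (h : IsCoxeterWeight s L) (a : Hecke s L) (j : B) :
    a.1 * rightMul s L j = rightMul s L j * a.1 := by
  obtain ⟨a, ha⟩ := a
  unfold Hecke at ha
  induction ha using Algebra.adjoin_induction with
  | mem x hx =>
    obtain ⟨i, rfl⟩ := hx
    exact h.leftMul_rightMul_comm i j
  | algebraMap r => exact Algebra.commutes r _
  | add x y _ _ hx hy => simp only [add_mul, mul_add, hx, hy] at *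
  | mul x y _ _ hx hy =>
    change x * y * _ = _ * (x * y)
    rw [mul_assoc, hy, ← mul_assoc, hx, mul_assoc]

/-- An element of the algebra commutes with all right multiplications, and these carry e_1 to every
e_w; it is therefore determined by its value at e_1. Relations in the algebra can then be checked on
that vector. -/
theorem coordsL_injective (h : IsCoxeterWeight s L) : Function.Injective (coordsL s L) := by
  rw [injective_iff_map_eq_zero]
  intro a ha
  apply Subtype.ext
  refine (regB G Γ).ext fun w => ?_
  rw [regB_apply]
  change a.1 _ = 0
  induction w using h.right_induction with
  | one => exact ha
  | mul i w hw ih =>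
    have e := rightMul_regBasis (s := s) (L := L) i w
    rw [if_pos hw] at e
    rw [← e, ← Module.End.mul_apply, h.commute_rightMul, Module.End.mul_apply, ih, map_zero]

theorem coordsL_word (h : IsCoxeterWeight s L) (ω : List B)
    (hω : ω.length = wordLength s (ω.map s).prod) :
    coordsL s L (ω.map (Tgen s L)).prod = regBasis (ω.map s).prod := by
  induction ω with
  | nil => rfl
  | cons i ω ih =>
    rw [List.map_cons, List.prod_cons, List.length_cons] at hω
    have h1 := wordLength_le s ω
    have h2 := h.wordLength_simple_mul i (ω.map s).prod
    rw [List.map_cons, List.prod_cons, coordsL_Tgen_mul, ih (by omega), leftMul_regBasis,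
      if_pos (by omega), List.map_cons, List.prod_cons]

theorem coordsL_T (h : IsCoxeterWeight s L) (w : G) : coordsL s L (T s L w) = regBasis w := by
  obtain ⟨h1, h2⟩ := h.isReducedWord_reducedWord w
  have := h.coordsL_word (reducedWord s w) (by rw [h1, h2])
  rwa [h1] at this

theorem coordsL_surjective (h : IsCoxeterWeight s L) : Function.Surjective (coordsL s L) := by
  rw [← LinearMap.range_eq_top, eq_top_iff, ← (regB G Γ).span_eq, Submodule.span_le]
  rintro _ ⟨w, rfl⟩
  exact ⟨T s L w, h.coordsL_T w⟩

/-- The basis `(T_w)` of the Iwahori--Hecke algebra. -/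
noncomputable def basisT (h : IsCoxeterWeight s L) :
    Module.Basis G (CoeffRing Γ) (Hecke s L) :=
  (regB G Γ).map (LinearEquiv.ofBijective (coordsL s L)
    ⟨h.coordsL_injective, h.coordsL_surjective⟩).symm

theorem basisT_apply (h : IsCoxeterWeight s L) (w : G) : h.basisT w = T s L w := by
  apply h.coordsL_injective
  rw [h.coordsL_T, basisT, Module.Basis.map_apply]
  exact LinearEquiv.apply_symm_apply (LinearEquiv.ofBijective (coordsL s L) _) _

theorem coe_basisT (h : IsCoxeterWeight s L) : (h.basisT : G → Hecke s L) = T s L :=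
  funext h.basisT_apply

theorem basisT_repr (h : IsCoxeterWeight s L) (a : Hecke s L) :
    h.basisT.repr a = coords s L a := rfl

open Classical in
theorem Tgen_mul_T (h : IsCoxeterWeight s L) (i : B) (w : G) :
    Tgen s L i * T s L w = if wordLength s w < wordLength s (s i * w) then T s L (s i * w)
      else T s L (s i * w) + xi s L i • T s L w := by
  apply h.coordsL_injective
  rw [coordsL_Tgen_mul, h.coordsL_T, leftMul_regBasis]
  split_ifs
  · rw [h.coordsL_T]
  · rw [map_add, map_smul, h.coordsL_T, h.coordsL_T]

theorem Tgen_mul_T_of_lt (h : IsCoxeterWeight s L) {i : B} {w : G}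
    (hw : wordLength s w < wordLength s (s i * w)) :
    Tgen s L i * T s L w = T s L (s i * w) := by
  rw [h.Tgen_mul_T, if_pos hw]

theorem T_one (h : IsCoxeterWeight s L) : T s L 1 = 1 := by
  apply h.coordsL_injective
  rw [h.coordsL_T]; rfl

theorem T_simple (h : IsCoxeterWeight s L) (i : B) : T s L (s i) = Tgen s L i := by
  have := h.Tgen_mul_T_of_lt (i := i) (w := 1) (by
    rw [mul_one, h.wordLength_simple, wordLength_one]; omega)
  rw [h.T_one, mul_one, mul_one] at this
  exact this.symm

theorem T_mul (h : IsCoxeterWeight s L) {w w' : G}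
    (hw : wordLength s (w * w') = wordLength s w + wordLength s w') :
    T s L w * T s L w' = T s L (w * w') := by
  induction w using h.left_induction with
  | one => rw [h.T_one, one_mul, one_mul]
  | mul i w hi ih =>
    have h1 := h.wordLength_simple_mul i w
    have h2 := h.wordLength_mul_le (s i) (w * w')
    have h3 := h.wordLength_mul_le w w'
    have h4 := h.wordLength_simple i
    rw [mul_assoc] at hw
    rw [← h.Tgen_mul_T_of_lt hi, mul_assoc, ih (by omega), h.Tgen_mul_T_of_lt (by omega),
      mul_assoc]

theorem Tgen_mul_self (h : IsCoxeterWeight s L) (i : B) :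
    Tgen s L i * Tgen s L i = 1 + xi s L i • Tgen s L i := by
  rw [← h.T_simple i]
  nth_rw 1 [h.T_simple i]
  rw [h.Tgen_mul_T, if_neg (by rw [h.sq, wordLength_one]; omega), h.sq, h.T_one]

theorem Tgen_mul_inv (h : IsCoxeterWeight s L) (i : B) :
    Tgen s L i * (Tgen s L i - xi s L i • 1) = 1 := by
  rw [mul_sub, h.Tgen_mul_self, mul_smul_comm, mul_one, add_sub_cancel_right]

theorem Tgen_inv_mul (h : IsCoxeterWeight s L) (i : B) :
    (Tgen s L i - xi s L i • 1) * Tgen s L i = 1 := by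
  rw [sub_mul, h.Tgen_mul_self, smul_mul_assoc, one_mul, add_sub_cancel_right]

theorem isUnit_T (h : IsCoxeterWeight s L) (w : G) : IsUnit (T s L w) := by
  induction w using h.left_induction with
  | one => rw [h.T_one]; exact isUnit_one
  | mul i w hi ih =>
    rw [← h.Tgen_mul_T_of_lt hi]
    exact IsUnit.mul ⟨⟨_, _, h.Tgen_mul_inv i, h.Tgen_inv_mul i⟩, rfl⟩ ih

theorem hecke_induction (h : IsCoxeterWeight s L) {P : Hecke s L → Prop}
    (zero : P 0) (add : ∀ a b, P a → P b → P (a + b))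
    (smul : ∀ (c : CoeffRing Γ) a, P a → P (c • a)) (T : ∀ w, P (T s L w)) (a : Hecke s L) : P a := by
  have ha : a ∈ Submodule.span (CoeffRing Γ) (Set.range (KLCells.T s L)) := by
    rw [← h.coe_basisT, h.basisT.span_eq]; trivial
  induction ha using Submodule.span_induction with
  | mem x hx => obtain ⟨w, rfl⟩ := hx; exact T w
  | zero => exact zero
  | add x y _ _ hx hy => exact add x y hx hy
  | smul c x _ hx => exact smul c x hx

end IsCoxeterWeight

end KLCells

namespace KLCells

/-! ### The coefficient ring -/

section Coeff

variable {Γ : Type*}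

/-- The coefficient of `e^γ` in `a`. -/
def coeffA (a : CoeffRing Γ) (γ : Γ) : ℤ := AddMonoidAlgebra.coeff (R := ℤ) a γ

theorem coeffA_ext {a b : CoeffRing Γ} (h : ∀ γ, coeffA a γ = coeffA b γ) : a = b :=
  AddMonoidAlgebra.coeff_injective (Finsupp.ext h)

variable [AddCommGroup Γ]

theorem coeffA_zero (γ : Γ) : coeffA (0 : CoeffRing Γ) γ = 0 := rfl

theorem coeffA_add (a b : CoeffRing Γ) (γ : Γ) : coeffA (a + b) γ = coeffA a γ + coeffA b γ := rfl

theorem coeffA_neg (a : CoeffRing Γ) (γ : Γ) : coeffA (-a) γ = -coeffA a γ := rfl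

theorem coeffA_sub (a b : CoeffRing Γ) (γ : Γ) : coeffA (a - b) γ = coeffA a γ - coeffA b γ := rfl

theorem coeffA_barA (a : CoeffRing Γ) (γ : Γ) : coeffA (barA a) γ = coeffA a (-γ) := by
  have h := Finsupp.mapDomain_apply (f := fun γ : Γ => -γ) neg_injective
    (AddMonoidAlgebra.coeff (R := ℤ) a) (-γ)
  rw [neg_neg] at h
  exact h

theorem barA_barA (a : CoeffRing Γ) : barA (barA a) = a :=
  coeffA_ext fun γ => by rw [coeffA_barA, coeffA_barA, neg_neg]

theorem barA_expo (γ : Γ) : barA (expo γ) = expo (-γ) := by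
  have := AddMonoidAlgebra.mapDomain_single (R := ℤ) (f := fun γ : Γ => -γ) (a := γ) (r := 1)
  exact this

variable [LinearOrder Γ]

theorem isNegA_iff {a : CoeffRing Γ} : IsNegA a ↔ ∀ γ, 0 ≤ γ → coeffA a γ = 0 := by
  unfold IsNegA coeffA
  refine forall_congr' fun γ => ?_
  rw [Finsupp.mem_support_iff, ← not_le]
  tauto

theorem isNegA_zero : IsNegA (0 : CoeffRing Γ) := isNegA_iff.mpr fun _ _ => rfl

theorem IsNegA.add {a b : CoeffRing Γ} (ha : IsNegA a) (hb : IsNegA b) : IsNegA (a + b) :=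
  isNegA_iff.mpr fun γ hγ => by
    rw [coeffA_add, isNegA_iff.mp ha γ hγ, isNegA_iff.mp hb γ hγ, add_zero]

theorem IsNegA.neg {a : CoeffRing Γ} (ha : IsNegA a) : IsNegA (-a) :=
  isNegA_iff.mpr fun γ hγ => by rw [coeffA_neg, isNegA_iff.mp ha γ hγ, neg_zero]

theorem isNegA_expo {γ : Γ} (h : γ < 0) : IsNegA (expo γ) := by
  intro γ' h'
  have := Finsupp.support_single_subset (show γ' ∈ (Finsupp.single γ (1 : ℤ)).support from h')
  rw [Finset.mem_singleton] at this
  rwa [this]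

/-- The part of `a` supported on negative exponents. -/
noncomputable def negPartA (a : CoeffRing Γ) : CoeffRing Γ :=
  AddMonoidAlgebra.ofCoeff (R := ℤ) ((AddMonoidAlgebra.coeff (R := ℤ) a).filter (· < 0))

theorem coeffA_negPartA (a : CoeffRing Γ) (γ : Γ) :
    coeffA (negPartA a) γ = if γ < 0 then coeffA a γ else 0 := Finsupp.filter_apply _ _ _

theorem isNegA_negPartA (a : CoeffRing Γ) : IsNegA (negPartA a) :=
  isNegA_iff.mpr fun γ hγ => by rw [coeffA_negPartA, if_neg (not_lt.mpr hγ)]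

theorem negPartA_zero : negPartA (0 : CoeffRing Γ) = 0 :=
  coeffA_ext fun γ => by rw [coeffA_negPartA, coeffA_zero, ite_self]

variable [IsOrderedAddMonoid Γ]

theorem IsNegA.mul {a b : CoeffRing Γ} (ha : IsNegA a) (hb : IsNegA b) : IsNegA (a * b) := by
  classical
  intro γ hγ
  obtain ⟨x, hx, y, hy, rfl⟩ := Finset.mem_add.mp
    (AddMonoidAlgebra.support_coeff_mul_subset (k := ℤ) (G := Γ) a b hγ)
  exact add_neg (ha x hx) (hb y hy)

/-- Bar invariance makes the coefficients symmetric under γ ↦ -γ. This is the source of all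
uniqueness below. -/
theorem IsNegA.eq_zero_of_barA {a : CoeffRing Γ} (ha : IsNegA a) (h : barA a = a) : a = 0 := by
  refine coeffA_ext fun γ => ?_
  rcases le_total 0 γ with hγ | hγ
  · exact isNegA_iff.mp ha γ hγ
  · rw [← h, coeffA_barA]
    exact isNegA_iff.mp ha _ (neg_nonneg.mpr hγ)

theorem negPartA_sub_barA {a : CoeffRing Γ} (h : barA a = -a) :
    negPartA a - barA (negPartA a) = a := by
  refine coeffA_ext fun γ => ?_
  have h1 : coeffA a (-γ) = -coeffA a γ := by rw [← coeffA_barA, h, coeffA_neg]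
  rw [coeffA_sub, coeffA_barA, coeffA_negPartA, coeffA_negPartA, h1]
  rcases lt_trichotomy γ 0 with hγ | hγ | hγ
  · rw [if_pos hγ, if_neg (by simpa using hγ.le), sub_zero]
  -- The constant coefficient equals its own negative, hence vanishes in ℤ.
  · subst hγ
    rw [neg_zero] at h1
    simp only [lt_self_iff_false, neg_zero, if_false]
    omega
  · rw [if_neg hγ.not_gt, if_pos (by simpa using hγ)]
    ring

end Coeff

/-! ### Bar invariant bases of modules with a triangular involution -/

section Triangular

open Finsupp (linearCombination)

variable {Γ P M : Type*} [AddCommGroup Γ] [AddCommGroup M] [Module (CoeffRing Γ) M]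

/-- The functions supported on the indices of rank less than `n`. -/
noncomputable def rankLT (Γ : Type*) [AddCommGroup Γ] {P : Type*} (r : P → ℕ) (n : ℕ) :
    Submodule (CoeffRing Γ) (P →₀ CoeffRing Γ) :=
  Finsupp.supported (CoeffRing Γ) (CoeffRing Γ) {q | r q < n}

theorem mem_rankLT {r : P → ℕ} {n : ℕ} {f : P →₀ CoeffRing Γ} :
    f ∈ rankLT Γ r n ↔ ∀ q, n ≤ r q → f q = 0 := by
  rw [rankLT, Finsupp.mem_supported, Set.subset_def]
  refine forall_congr' fun q => ?_
  rw [Finset.mem_coe, Finsupp.mem_support_iff, Set.mem_ofPred_eq, ← not_le]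
  tauto

theorem exists_mem_rankLT (r : P → ℕ) (f : P →₀ CoeffRing Γ) : ∃ n, f ∈ rankLT Γ r n := by
  refine ⟨f.support.sup r + 1, mem_rankLT.mpr fun q hq => ?_⟩
  by_contra h
  have := Finset.le_sup (f := r) (Finsupp.mem_support_iff.mpr h)
  omega

theorem rankLT_zero {r : P → ℕ} {f : P →₀ CoeffRing Γ} (hf : f ∈ rankLT Γ r 0) : f = 0 :=
  Finsupp.ext fun q => mem_rankLT.mp hf q (Nat.zero_le _)

theorem rankLT_mono {r : P → ℕ} {m n : ℕ} (hmn : m ≤ n) :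
    rankLT Γ r m ≤ rankLT Γ r n := fun _ hf =>
  mem_rankLT.mpr fun q hq => mem_rankLT.mp hf q (hmn.trans hq)

/-- Each F p has ranks strictly below that of p, so the bound drops by one. A layer of given rank
may be infinite; inductions on the rank bound still work since each function has finite support. -/
theorem linearCombination_mem_rankLT {r : P → ℕ} {F : P → P →₀ CoeffRing Γ}
    (hF : ∀ p, F p ∈ rankLT Γ r (r p)) {n : ℕ} {f : P →₀ CoeffRing Γ}
    (hf : f ∈ rankLT Γ r (n + 1)) :
    linearCombination (CoeffRing Γ) F f ∈ rankLT Γ r n := by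
  rw [Finsupp.linearCombination_apply]
  refine Submodule.sum_mem _ fun q hq => Submodule.smul_mem _ _ ?_
  refine mem_rankLT.mpr fun p hp => mem_rankLT.mp (hF q) p ?_
  by_contra hlt
  exact Finsupp.mem_support_iff.mp hq (mem_rankLT.mp hf q (by omega))

theorem linearCombination_add_comp (t : P → M) (F : P → P →₀ CoeffRing Γ) (f : P →₀ CoeffRing Γ) :
    linearCombination (CoeffRing Γ) (fun p => t p + linearCombination (CoeffRing Γ) t (F p)) f =
      linearCombination (CoeffRing Γ) t (f + linearCombination (CoeffRing Γ) F f) := by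
  rw [map_add, Finsupp.linearCombination_apply, Finsupp.linearCombination_apply,
    Finsupp.linearCombination_apply (CoeffRing Γ) f (v := F), map_finsuppSum, ← Finsupp.sum_add]
  simp only [smul_add, map_smul]

variable {t c : P → M} {r : P → ℕ}

/-- The family `c` is obtained from `t` by a unitriangular transformation. -/
def IsUnitriangular (Γ : Type*) [AddCommGroup Γ] [Module (CoeffRing Γ) M] (t c : P → M)
    (r : P → ℕ) : Prop :=
  ∀ p, ∃ f ∈ rankLT Γ r (r p), c p = t p + linearCombination (CoeffRing Γ) t f

theorem IsUnitriangular.exists_eq (h : IsUnitriangular Γ t c r) :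
    ∃ F : P → P →₀ CoeffRing Γ, (∀ p, F p ∈ rankLT Γ r (r p)) ∧
      c = fun p => t p + linearCombination (CoeffRing Γ) t (F p) := by
  choose F h1 h2 using h
  exact ⟨F, h1, funext h2⟩

/-- Lower-order corrections do not reach the layer of top rank, so the coefficients of a relation
vanish there, and one descends. -/
theorem IsUnitriangular.linearIndependent (h : IsUnitriangular Γ t c r)
    (ht : LinearIndependent (CoeffRing Γ) t) : LinearIndependent (CoeffRing Γ) c := by
  obtain ⟨F, hF, rfl⟩ := h.exists_eq
  rw [linearIndependent_iff]
  intro f hf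
  rw [linearCombination_add_comp] at hf
  replace hf := linearIndependent_iff.mp ht _ hf
  obtain ⟨n, hn⟩ := exists_mem_rankLT r f
  induction n with
  | zero => exact rankLT_zero hn
  | succ n ih =>
    refine ih (mem_rankLT.mpr fun q hq => ?_)
    have h1 := DFunLike.congr_fun hf q
    rwa [Finsupp.add_apply, mem_rankLT.mp (linearCombination_mem_rankLT hF hn) q hq,
      add_zero] at h1

theorem IsUnitriangular.mem_span (h : IsUnitriangular Γ t c r) (p : P) :
    t p ∈ Submodule.span (CoeffRing Γ) (Set.range c) := by
  induction hn : r p using Nat.strong_induction_on generalizing p with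
  | _ n ih =>
    obtain ⟨f, hf, e⟩ := h p
    rw [← sub_eq_iff_eq_add] at e
    rw [← e]
    refine Submodule.sub_mem _ (Submodule.subset_span ⟨p, rfl⟩) ?_
    rw [Finsupp.linearCombination_apply]
    refine Submodule.sum_mem _ fun q hq => Submodule.smul_mem _ _ (ih (r q) ?_ q rfl)
    by_contra hlt
    exact Finsupp.mem_support_iff.mp hq (mem_rankLT.mp hf q (by omega))

theorem IsUnitriangular.span_le (h : IsUnitriangular Γ t c r) :
    Submodule.span (CoeffRing Γ) (Set.range t) ≤ Submodule.span (CoeffRing Γ) (Set.range c) := by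
  rw [Submodule.span_le]
  rintro _ ⟨p, rfl⟩
  exact h.mem_span p

variable {β : M →ₛₗ[barA (Γ := Γ)] M}

theorem map_linearCombination_barA (f : P →₀ CoeffRing Γ) :
    β (linearCombination (CoeffRing Γ) t f) =
      linearCombination (CoeffRing Γ) (β ∘ t) (f.mapRange barA (map_zero barA)) := by
  rw [Finsupp.linearCombination_apply, map_finsuppSum, Finsupp.linearCombination_apply,
    Finsupp.sum_mapRange_index (h := fun p a => a • (β ∘ t) p) (fun _ => zero_smul _ _)]
  simp only [map_smulₛₗ, Function.comp]

/-- On the top layer, that of rank n, the involution only conjugates the coefficients; the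
correction g lies in smaller ranks. -/
theorem IsUnitriangular.map_linearCombination (h : IsUnitriangular Γ t (β ∘ t) r) {n : ℕ}
    {f : P →₀ CoeffRing Γ} (hf : f ∈ rankLT Γ r (n + 1)) :
    ∃ g ∈ rankLT Γ r n, β (linearCombination (CoeffRing Γ) t f) =
      linearCombination (CoeffRing Γ) t (f.mapRange barA (map_zero barA) + g) := by
  obtain ⟨F, hF, e⟩ := h.exists_eq
  refine ⟨_, linearCombination_mem_rankLT hF (f := f.mapRange barA (map_zero barA)) ?_, ?_⟩
  · refine mem_rankLT.mpr fun q hq => ?_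
    rw [Finsupp.mapRange_apply, mem_rankLT.mp hf q hq, map_zero]
  · rw [map_linearCombination_barA, e, linearCombination_add_comp]

variable [LinearOrder Γ] [IsOrderedAddMonoid Γ]

/-- Top-rank coefficients are bar invariant and in A_{<0}, hence zero; descend on the rank. -/
theorem IsUnitriangular.eq_zero_of_invariant (h : IsUnitriangular Γ t (β ∘ t) r)
    (ht : LinearIndependent (CoeffRing Γ) t) {f : P →₀ CoeffRing Γ} (hf : ∀ q, IsNegA (f q))
    (hβ : β (linearCombination (CoeffRing Γ) t f) = linearCombination (CoeffRing Γ) t f) :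
    f = 0 := by
  obtain ⟨n, hn⟩ := exists_mem_rankLT r f
  induction n with
  | zero => exact rankLT_zero hn
  | succ n ih =>
    refine ih (mem_rankLT.mpr fun q hq => ?_)
    obtain ⟨g, hg, e⟩ := h.map_linearCombination hn
    have h1 := DFunLike.congr_fun (ht (e.symm.trans hβ)) q
    rw [Finsupp.add_apply, mem_rankLT.mp hg q hq, add_zero, Finsupp.mapRange_apply] at h1
    exact (hf q).eq_zero_of_barA h1

/-- The equation d - β d = f is solved layer by layer. Top coefficients of an anti-invariant f
satisfy bar a = -a, so a = a⁻ - bar a⁻ for their negative parts a⁻; subtracting this solution lowers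
the rank. -/
theorem IsUnitriangular.exists_sub_map (h : IsUnitriangular Γ t (β ∘ t) r)
    (ht : LinearIndependent (CoeffRing Γ) t) (hβ : ∀ m, β (β m) = m) (n : ℕ) {f : P →₀ CoeffRing Γ}
    (hf : f ∈ rankLT Γ r n)
    (e : β (linearCombination (CoeffRing Γ) t f) = -linearCombination (CoeffRing Γ) t f) :
    ∃ d ∈ rankLT Γ r n, (∀ q, IsNegA (d q)) ∧
      linearCombination (CoeffRing Γ) t d - β (linearCombination (CoeffRing Γ) t d) =
        linearCombination (CoeffRing Γ) t f := by
  induction n generalizing f with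
  | zero =>
    obtain rfl := rankLT_zero hf
    exact ⟨0, hf, fun _ => isNegA_zero, by simp⟩
  | succ n ih =>
    obtain ⟨g, hg, e1⟩ := h.map_linearCombination hf
    -- Since f lives in ranks at most n, the filter keeps exactly the layer of rank n.
    set d := (f.filter (fun q => n ≤ r q)).mapRange negPartA negPartA_zero with hd_def
    have hd_apply : ∀ q, d q = if n ≤ r q then negPartA (f q) else 0 := by
      intro q
      rw [hd_def, Finsupp.mapRange_apply, Finsupp.filter_apply]
      split_ifs
      · rfl
      · exact negPartA_zero
    have hd : d ∈ rankLT Γ r (n + 1) := mem_rankLT.mpr fun q hq => by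
      rw [hd_apply, mem_rankLT.mp hf q hq, negPartA_zero, ite_self]
    have hd_neg : ∀ q, IsNegA (d q) := fun q => by
      rw [hd_apply]
      split_ifs
      · exact isNegA_negPartA _
      · exact isNegA_zero
    obtain ⟨g', hg', e2⟩ := h.map_linearCombination hd
    have hbar : ∀ q, n ≤ r q → barA (f q) = -f q := fun q hq => by
      rw [e1, ← map_neg] at e
      have h1 := DFunLike.congr_fun (ht e) q
      rwa [Finsupp.add_apply, mem_rankLT.mp hg q hq, add_zero, Finsupp.mapRange_apply] at h1
    have hf' : f - d + (d.mapRange barA (map_zero barA) + g') ∈ rankLT Γ r n :=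
      mem_rankLT.mpr fun q hq => by
        rw [Finsupp.add_apply, Finsupp.add_apply, Finsupp.sub_apply, mem_rankLT.mp hg' q hq,
          Finsupp.mapRange_apply (hf := map_zero barA), hd_apply, if_pos hq, add_zero]
        have := negPartA_sub_barA (hbar q hq)
        rw [sub_add, this, sub_self]
    have e3 : linearCombination (CoeffRing Γ) t (f - d + (d.mapRange barA (map_zero barA) + g')) =
        linearCombination (CoeffRing Γ) t f - linearCombination (CoeffRing Γ) t d +
          β (linearCombination (CoeffRing Γ) t d) := by
      rw [e2, map_add, map_sub]
    obtain ⟨d', hd', hneg', e4⟩ := ih hf' (by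
      rw [e3, map_add, map_sub, e, hβ]; abel)
    refine ⟨d + d', Submodule.add_mem _ hd (mem_rankLT.mpr fun q hq =>
      mem_rankLT.mp hd' q (by omega)), fun q => (hd_neg q).add (hneg' q), ?_⟩
    rw [e3] at e4
    rw [map_add, map_add, add_sub_add_comm, e4]
    abel

/-- The element β t_p - t_p is anti-invariant and of lower rank. Solving d - β d = β t_p - t_p makes
t_p + d invariant. This is applied to the T_w, and again to the mixed pairs. -/
theorem IsUnitriangular.exists_invariant (h : IsUnitriangular Γ t (β ∘ t) r)
    (ht : LinearIndependent (CoeffRing Γ) t) (hβ : ∀ m, β (β m) = m) (p : P) :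
    ∃ d ∈ rankLT Γ r (r p), (∀ q, IsNegA (d q)) ∧
      β (t p + linearCombination (CoeffRing Γ) t d) =
        t p + linearCombination (CoeffRing Γ) t d := by
  obtain ⟨f, hf, e⟩ := h p
  rw [Function.comp] at e
  have e' : linearCombination (CoeffRing Γ) t f = β (t p) - t p := by rw [e]; abel
  obtain ⟨d, hd, hneg, e1⟩ := h.exists_sub_map ht hβ (r p) hf (by
    rw [e', map_sub, hβ]; abel)
  refine ⟨d, hd, hneg, ?_⟩
  rw [map_add, e, ← e1]
  abel

end Triangular

end KLCells

namespace KLCells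

open Finsupp (linearCombination)

section

variable {B G Γ : Type*} [AddCommGroup Γ] {s : B → G} {L : G → Γ}

theorem barA_xi (i : B) : barA (xi s L i) = -xi s L i := by
  rw [xi, map_sub, barA_expo, barA_expo, neg_neg, neg_sub]

variable [Group G]

theorem coords_add (a b : Hecke s L) (y : G) :
    coords s L (a + b) y = coords s L a y + coords s L b y := rfl

theorem coords_smul (c : CoeffRing Γ) (a : Hecke s L) (y : G) :
    coords s L (c • a) y = c * coords s L a y := rfl

end

variable {B G Γ : Type*} [Group G] [AddCommGroup Γ] [LinearOrder Γ] {s : B → G} {L : G → Γ}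

/-! ### The bar involution -/

/-- The bar involution as a semilinear map. -/
noncomputable def barL (h : IsCoxeterWeight s L) :
    Hecke s L →ₛₗ[barA (Γ := Γ)] Hecke s L where
  toFun := barH s L
  map_add' a b := by
    unfold barH
    simp only [← h.basisT_repr, map_add]
    exact Finsupp.sum_add_index' (fun _ => by simp) fun _ _ _ => by rw [map_add, add_smul]
  map_smul' c a := by
    unfold barH
    simp only [← h.basisT_repr, map_smul]
    rw [Finsupp.sum_smul_index (fun _ => by simp), Finsupp.smul_sum]
    simp only [map_mul, mul_smul]

theorem barL_apply (h : IsCoxeterWeight s L) (a : Hecke s L) : barL h a = barH s L a := rfl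

namespace IsCoxeterWeight

theorem barL_T (h : IsCoxeterWeight s L) (w : G) :
    barL h (T s L w) = Ring.inverse (T s L w⁻¹) := by
  rw [barL_apply, barH, ← h.basisT_repr, ← h.basisT_apply, Module.Basis.repr_self,
    Finsupp.sum_single_index (by simp), map_one, one_smul]

theorem barL_one (h : IsCoxeterWeight s L) : barL h 1 = 1 := by
  rw [← h.T_one, h.barL_T, inv_one, h.T_one, Ring.inverse_one]

theorem barL_T_mul_T_inv (h : IsCoxeterWeight s L) (w : G) :
    barL h (T s L w) * T s L w⁻¹ = 1 := by
  rw [h.barL_T, Ring.inverse_mul_cancel _ (h.isUnit_T _)]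

theorem T_inv_mul_barL_T (h : IsCoxeterWeight s L) (w : G) :
    T s L w⁻¹ * barL h (T s L w) = 1 := by
  rw [h.barL_T, Ring.mul_inverse_cancel _ (h.isUnit_T _)]

theorem barL_Tgen (h : IsCoxeterWeight s L) (i : B) :
    barL h (Tgen s L i) = Tgen s L i - xi s L i • 1 := by
  have h1 := h.T_inv_mul_barL_T (s i)
  rw [h.inv_simple, h.T_simple] at h1
  exact (left_inv_eq_right_inv (h.Tgen_inv_mul i) h1).symm

/-- Both sides are inverse to T_{(sw)⁻¹} = T_{w⁻¹} T_s. -/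
theorem barL_T_simple_mul (h : IsCoxeterWeight s L) {i : B} {w : G}
    (hw : wordLength s w < wordLength s (s i * w)) :
    barL h (T s L (s i * w)) = barL h (Tgen s L i) * barL h (T s L w) := by
  refine left_inv_eq_right_inv (h.barL_T_mul_T_inv (s i * w)) ?_
  have h1 := h.wordLength_simple_mul i w
  have h2 : T s L (s i * w)⁻¹ = T s L w⁻¹ * Tgen s L i := by
    rw [← h.T_simple, mul_inv_rev, h.inv_simple, h.T_mul]
    rw [h.wordLength_simple, h.wordLength_inv, ← h.inv_simple, ← mul_inv_rev, h.wordLength_inv]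
    omega
  have h3 := h.T_inv_mul_barL_T (s i)
  rw [h.inv_simple, h.T_simple] at h3
  rw [h2, mul_assoc, ← mul_assoc (Tgen s L i), h3, one_mul, h.T_inv_mul_barL_T]

theorem barL_Tgen_mul (h : IsCoxeterWeight s L) (i : B) (a : Hecke s L) :
    barL h (Tgen s L i * a) = barL h (Tgen s L i) * barL h a := by
  induction a using h.hecke_induction with
  | zero => rw [mul_zero, map_zero, mul_zero]
  | add a b ha hb => rw [mul_add, map_add, map_add, mul_add, ha, hb]
  | smul c a ha => rw [mul_smul_comm, map_smulₛₗ, map_smulₛₗ, mul_smul_comm, ha]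
  | T w =>
    rcases h.wordLength_simple_mul i w with hw | hw
    · rw [h.Tgen_mul_T_of_lt (by omega), h.barL_T_simple_mul (by omega)]
    -- For a descent, T_w = T_s T_{sw} with an ascent from sw. The claim then follows from the
    -- quadratic relation for bar T_s.
    · have h1 : wordLength s (s i * w) < wordLength s (s i * (s i * w)) := by
        rw [h.simple_mul_cancel]; omega
      have h2 := h.barL_T_simple_mul h1
      have h3 := h.Tgen_mul_T_of_lt h1
      rw [h.simple_mul_cancel] at h2 h3
      have h4 : barL h (Tgen s L i) * barL h (Tgen s L i) =
          1 - xi s L i • barL h (Tgen s L i) := by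
        rw [h.barL_Tgen, sub_mul, mul_sub, mul_sub, h.Tgen_mul_self]
        simp only [mul_smul_comm, smul_mul_assoc, mul_one, one_mul, smul_sub]
        abel
      rw [h.Tgen_mul_T, if_neg (by omega), map_add, map_smulₛₗ, barA_xi, h2, ← mul_assoc, h4,
        sub_mul, one_mul, smul_mul_assoc]
      module

theorem barL_mul (h : IsCoxeterWeight s L) (a b : Hecke s L) :
    barL h (a * b) = barL h a * barL h b := by
  induction a using h.hecke_induction with
  | zero => rw [zero_mul, map_zero, zero_mul]
  | add a a' ha hb => rw [add_mul, map_add, map_add, add_mul, ha, hb]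
  | smul c a ha => rw [smul_mul_assoc, map_smulₛₗ, map_smulₛₗ, smul_mul_assoc, ha]
  | T w =>
    induction w using h.left_induction with
    | one => rw [h.T_one, h.barL_one, one_mul, one_mul]
    | mul i w hw ih =>
      rw [← h.Tgen_mul_T_of_lt hw, mul_assoc, h.barL_Tgen_mul, ih, h.barL_Tgen_mul, mul_assoc]

theorem barL_barL (h : IsCoxeterWeight s L) (a : Hecke s L) : barL h (barL h a) = a := by
  induction a using h.hecke_induction with
  | zero => rw [map_zero, map_zero]
  | add a b ha hb => rw [map_add, map_add, ha, hb]
  | smul c a ha => rw [map_smulₛₗ, map_smulₛₗ, ha, barA_barA]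
  | T w =>
    have h1 : barL h (barL h (T s L w)) * barL h (T s L w⁻¹) = 1 := by
      rw [← h.barL_mul, h.barL_T_mul_T_inv, h.barL_one]
    have h2 := h.barL_T_mul_T_inv w⁻¹
    rw [inv_inv] at h2
    exact left_inv_eq_right_inv h1 h2

theorem Tgen_mul_mem (h : IsCoxeterWeight s L) (i : B) {n : ℕ} {f : G →₀ CoeffRing Γ}
    (hf : f ∈ rankLT Γ (wordLength s) n) :
    ∃ g ∈ rankLT Γ (wordLength s) (n + 1), Tgen s L i * linearCombination _ (T s L) f =
      linearCombination _ (T s L) g := by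
  have key : ∀ w, wordLength s w < n → ∃ g ∈ rankLT Γ (wordLength s) (n + 1),
      Tgen s L i * T s L w = linearCombination _ (T s L) g := by
    intro w hw
    have hmem : ∀ y, wordLength s y < n + 1 →
        Finsupp.single y 1 ∈ rankLT Γ (wordLength s) (n + 1) := fun y hy =>
      mem_rankLT.mpr fun q hq => Finsupp.single_eq_of_ne (by rintro rfl; omega)
    rcases h.wordLength_simple_mul i w with h1 | h1
    · refine ⟨_, hmem (s i * w) (by omega), ?_⟩
      rw [h.Tgen_mul_T_of_lt (by omega), Finsupp.linearCombination_single, one_smul]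
    · refine ⟨_, Submodule.add_mem _ (hmem (s i * w) (by omega))
        (Submodule.smul_mem _ (xi s L i) (hmem w (by omega))), ?_⟩
      rw [h.Tgen_mul_T, if_neg (by omega), map_add, map_smul, Finsupp.linearCombination_single,
        Finsupp.linearCombination_single, one_smul, one_smul]
  have h1 : Tgen s L i * linearCombination _ (T s L) f ∈
      (rankLT Γ (wordLength s) (n + 1)).map (linearCombination (CoeffRing Γ) (T s L)) := by
    rw [Finsupp.linearCombination_apply, Finsupp.sum, Finset.mul_sum]
    refine Submodule.sum_mem _ fun w hw => ?_
    rw [mul_smul_comm]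
    refine Submodule.smul_mem _ _ ?_
    obtain ⟨g, hg, e⟩ := key w (by
      by_contra hlt
      exact Finsupp.mem_support_iff.mp hw (mem_rankLT.mp hf w (by omega)))
    exact ⟨g, hg, e.symm⟩
  obtain ⟨g, hg, e⟩ := h1
  exact ⟨g, hg, e.symm⟩

/-- For an ascent, bar T_{sw} = (T_s - ξ_s) bar T_w, and multiplication by T_s raises lengths by at
most one. -/
theorem isUnitriangular_barL (h : IsCoxeterWeight s L) :
    IsUnitriangular Γ (T s L) (barL h ∘ T s L) (wordLength s) := by
  intro w
  rw [Function.comp]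
  induction w using h.left_induction with
  | one => exact ⟨0, Submodule.zero_mem _, by rw [h.T_one, h.barL_one, map_zero, add_zero]⟩
  | mul i w hw ih =>
    obtain ⟨f, hf, e⟩ := ih
    have hw' := h.wordLength_simple_mul i w
    obtain ⟨g, hg, e1⟩ := h.Tgen_mul_mem i hf
    have h1 : Finsupp.single w 1 ∈ rankLT Γ (wordLength s) (wordLength s (s i * w)) :=
      mem_rankLT.mpr fun q hq => Finsupp.single_eq_of_ne (by rintro rfl; omega)
    refine ⟨g - xi s L i • (Finsupp.single w 1 + f), Submodule.sub_mem _
      (rankLT_mono (by omega) hg) (Submodule.smul_mem _ _ (Submodule.add_mem _ h1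
      (rankLT_mono (by omega) hf))), ?_⟩
    rw [← h.Tgen_mul_T_of_lt hw, h.barL_mul, e, h.barL_Tgen, sub_mul, mul_add, e1, map_sub,
      map_smul, map_add, Finsupp.linearCombination_single, smul_mul_assoc, one_mul, one_smul]
    abel

theorem linearIndependent_T (h : IsCoxeterWeight s L) :
    LinearIndependent (CoeffRing Γ) (T s L) := by
  rw [← h.coe_basisT]
  exact h.basisT.linearIndependent

end IsCoxeterWeight

/-! ### The Kazhdan--Lusztig basis -/

/-- All coefficients of `a` with respect to the basis `(T_w)` are in `A_{<0}`. -/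
def IsNegH (a : Hecke s L) : Prop := ∀ y, IsNegA (coords s L a y)

theorem isNegH_zero : IsNegH (0 : Hecke s L) := fun _ => isNegA_zero

theorem IsNegH.add {a b : Hecke s L} (ha : IsNegH a) (hb : IsNegH b) : IsNegH (a + b) :=
  fun y => (ha y).add (hb y)

theorem isNegH_sum {ι : Type*} {t : Finset ι} {f : ι → Hecke s L} (hf : ∀ i ∈ t, IsNegH (f i)) :
    IsNegH (∑ i ∈ t, f i) := Finset.sum_induction _ _ (fun _ _ => IsNegH.add) isNegH_zero hf

namespace IsCoxeterWeight

theorem coords_T (h : IsCoxeterWeight s L) (w : G) : coords s L (T s L w) = Finsupp.single w 1 := by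
  rw [← h.basisT_repr, ← h.basisT_apply, Module.Basis.repr_self]

theorem isNegH_smul_T (h : IsCoxeterWeight s L) {c : CoeffRing Γ} (hc : IsNegA c) (w : G) :
    IsNegH (c • T s L w) := fun y => by
  classical
  rw [coords_smul, h.coords_T, Finsupp.single_apply]
  split_ifs
  · rwa [mul_one]
  · rw [mul_zero]; exact isNegA_zero

variable [IsOrderedAddMonoid Γ]

/-- If `a ≡ T_w` modulo `∑ A_{<0} T_y` and `c ∈ A_{<0}`, then `c a ∈ ∑ A_{<0} T_y`. -/
theorem isNegH_smul (h : IsCoxeterWeight s L) {c : CoeffRing Γ} (hc : IsNegA c) {w : G}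
    {a : Hecke s L} (ha : IsNegH (a - T s L w)) : IsNegH (c • a) := by
  have e : c • a = c • T s L w + c • (a - T s L w) := by rw [smul_sub]; abel
  rw [e]
  exact (h.isNegH_smul_T hc w).add fun y => by
    rw [coords_smul]
    exact hc.mul (ha y)

theorem eq_zero_of_barL (h : IsCoxeterWeight s L) {a : Hecke s L} (ha : IsNegH a)
    (hb : barL h a = a) : a = 0 := by
  have e : linearCombination (CoeffRing Γ) (T s L) (h.basisT.repr a) = a := by
    rw [← h.coe_basisT, h.basisT.linearCombination_repr]
  have h1 := h.isUnitriangular_barL.eq_zero_of_invariant h.linearIndependent_T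
    (f := h.basisT.repr a) ha (by rw [e, hb])
  rwa [LinearEquiv.map_eq_zero_iff] at h1

theorem exists_isKL (h : IsCoxeterWeight s L) (w : G) :
    ∃ c, IsKL s L w c ∧ ∃ d ∈ rankLT Γ (wordLength s) (wordLength s w),
      c = T s L w + linearCombination (CoeffRing Γ) (T s L) d := by
  obtain ⟨d, hd, hneg, e⟩ :=
    h.isUnitriangular_barL.exists_invariant h.linearIndependent_T h.barL_barL w
  refine ⟨_, ⟨e, fun y => ?_⟩, d, hd, rfl⟩
  rw [add_sub_cancel_left, ← h.basisT_repr, ← h.coe_basisT,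
    h.basisT.repr_linearCombination]
  exact hneg y

theorem eq_of_isKL (h : IsCoxeterWeight s L) {w : G} {c c' : Hecke s L} (hc : IsKL s L w c)
    (hc' : IsKL s L w c') : c = c' := by
  rw [← sub_eq_zero]
  refine h.eq_zero_of_barL (fun y => ?_) ?_
  · have e : c - c' = (c - T s L w) + -(1 : CoeffRing Γ) • (c' - T s L w) := by module
    rw [e, coords_add, coords_smul, neg_one_mul]
    exact (hc.2 y).add (hc'.2 y).neg
  · rw [map_sub, barL_apply, barL_apply, hc.1, hc'.1]

theorem isKL_KL (h : IsCoxeterWeight s L) (w : G) : IsKL s L w (KL s L w) :=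
  Classical.epsilon_spec ((h.exists_isKL w).imp fun _ hc => hc.1)

theorem barL_KL (h : IsCoxeterWeight s L) (w : G) : barL h (KL s L w) = KL s L w :=
  (h.isKL_KL w).1

theorem isNegH_KL_sub_T (h : IsCoxeterWeight s L) (w : G) : IsNegH (KL s L w - T s L w) :=
  (h.isKL_KL w).2

theorem eq_KL (h : IsCoxeterWeight s L) {w : G} {c : Hecke s L} (hb : barL h c = c)
    (hc : IsNegH (c - T s L w)) : c = KL s L w :=
  h.eq_of_isKL ⟨hb, hc⟩ (h.isKL_KL w)

theorem isUnitriangular_KL (h : IsCoxeterWeight s L) :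
    IsUnitriangular Γ (T s L) (KL s L) (wordLength s) := by
  intro w
  obtain ⟨c, hc, d, hd, e⟩ := h.exists_isKL w
  exact ⟨d, hd, (h.eq_of_isKL (h.isKL_KL w) hc).trans e⟩

/-- The Kazhdan--Lusztig basis. -/
noncomputable def basisKL (h : IsCoxeterWeight s L) :
    Module.Basis G (CoeffRing Γ) (Hecke s L) :=
  Module.Basis.mk (h.isUnitriangular_KL.linearIndependent h.linearIndependent_T) (by
    refine le_trans ?_ h.isUnitriangular_KL.span_le
    rw [← h.coe_basisT, h.basisT.span_eq])

theorem basisKL_apply (h : IsCoxeterWeight s L) (w : G) : h.basisKL w = KL s L w :=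
  Module.Basis.mk_apply _ _ _

theorem coe_basisKL (h : IsCoxeterWeight s L) : (h.basisKL : G → Hecke s L) = KL s L :=
  funext h.basisKL_apply

/-- The C_z form a basis, so the chosen coefficients are the coordinates. -/
theorem structConst_eq (h : IsCoxeterWeight s L) (x y : G) :
    structConst s L x y = h.basisKL.repr (KL s L x * KL s L y) := by
  have h1 : ∃ f, KL s L x * KL s L y = linearCombination (CoeffRing Γ) (KL s L) f :=
    ⟨h.basisKL.repr (KL s L x * KL s L y), by
      rw [← h.coe_basisKL, h.basisKL.linearCombination_repr]⟩
  have h2 : KL s L x * KL s L y = linearCombination (CoeffRing Γ) (KL s L) (structConst s L x y) :=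
    Classical.epsilon_spec h1
  rw [h2, ← h.coe_basisKL, h.basisKL.repr_linearCombination]

theorem KL_simple (h : IsCoxeterWeight s L) (i : B) :
    KL s L (s i) = Tgen s L i + expo (-L (s i)) • 1 := by
  refine (h.eq_KL ?_ ?_).symm
  · rw [map_add, map_smulₛₗ, h.barL_Tgen, h.barL_one, barA_expo, neg_neg, xi]
    module
  · rw [h.T_simple, add_sub_cancel_left, ← h.T_one]
    exact h.isNegH_smul_T (isNegA_expo (neg_lt_zero.mpr (h.weight_pos i))) 1

end IsCoxeterWeight

end KLCells

namespace KLCells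

open Finsupp (linearCombination)

variable {B G Γ : Type*} [Group G] [AddCommGroup Γ] [LinearOrder Γ] {s : B → G} {L : G → Γ}

/-! ### The left pre-order and left ideals -/

theorem LeftLE.refl (x : G) : LeftLE s L x x := Relation.ReflTransGen.refl

theorem LeftLE.trans {x y z : G} (h1 : LeftLE s L x y) (h2 : LeftLE s L y z) : LeftLE s L x z :=
  Relation.ReflTransGen.trans h1 h2

/-- The pre-order is defined through the C_s alone, but T_s differs from C_s by a scalar and the T_s
generate the algebra, so multiplication by any element moves down in it. -/
theorem IsCoxeterWeight.leftLE_of_repr_mul_ne [IsOrderedAddMonoid Γ] (h : IsCoxeterWeight s L)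
    (a : Hecke s L) {x y : G} (hne : h.basisKL.repr (a * KL s L x) y ≠ 0) : LeftLE s L y x := by
  induction a using h.hecke_induction generalizing x y with
  | zero => rw [zero_mul, map_zero] at hne; exact absurd rfl hne
  | add a b ha hb =>
    rw [add_mul, map_add, Finsupp.add_apply] at hne
    by_cases h1 : h.basisKL.repr (a * KL s L x) y = 0
    · rw [h1, zero_add] at hne
      exact hb hne
    · exact ha h1
  | smul c a ha =>
    rw [smul_mul_assoc, map_smul, Finsupp.smul_apply] at hne
    exact ha fun h1 => hne (by rw [h1, smul_zero])
  | T w =>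
    induction w using h.left_induction generalizing x y with
    | one =>
      classical
      rw [h.T_one, one_mul, ← h.basisKL_apply, h.basisKL.repr_self, Finsupp.single_apply] at hne
      obtain rfl : x = y := by_contra fun h1 => hne (if_neg h1)
      exact LeftLE.refl _
    | mul i w hw ih =>
      have e : T s L (s i * w) * KL s L x =
          (h.basisKL.repr (T s L w * KL s L x)).sum fun z c => c • (Tgen s L i * KL s L z) := by
        rw [← h.Tgen_mul_T_of_lt hw, mul_assoc]
        conv_lhs => rw [← h.basisKL.linearCombination_repr (T s L w * KL s L x),
          Finsupp.linearCombination_apply, Finsupp.sum, Finset.mul_sum]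
        simp only [mul_smul_comm, h.basisKL_apply, Finsupp.sum]
      rw [e, Finsupp.sum, map_sum, Finsupp.finsetSum_apply] at hne
      obtain ⟨z, hz, hz'⟩ := Finset.exists_ne_zero_of_sum_ne_zero hne
      have hzx := ih (Finsupp.mem_support_iff.mp hz)
      rw [map_smul, Finsupp.smul_apply] at hz'
      refine LeftLE.trans ?_ hzx
      have e2 : Tgen s L i * KL s L z = KL s L (s i) * KL s L z - expo (-L (s i)) • KL s L z := by
        rw [h.KL_simple, add_mul, smul_mul_assoc, one_mul, add_sub_cancel_right]
      by_cases hyz : y = z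
      · rw [hyz]; exact LeftLE.refl _
      -- For y ≠ z the coefficients of C_y in T_s C_z and in C_s C_z coincide.
      · refine Relation.ReflTransGen.single ⟨i, fun h0 => hz' ?_⟩
        rw [e2, map_sub, Finsupp.sub_apply, ← h.structConst_eq, h0, map_smul, ← h.basisKL_apply z,
          h.basisKL.repr_self, Finsupp.smul_apply, Finsupp.single_eq_of_ne hyz]
        simp

/-- The elements strictly below a left cell. -/
def cellBelow (s : B → G) (L : G → Γ) (C : Set G) : Set G :=
  {y | y ∉ C ∧ ∃ x ∈ C, LeftLE s L y x}

theorem mem_or_mem_cellBelow {C : Set G} {x y : G} (hx : x ∈ C) (hyx : LeftLE s L y x) :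
    y ∈ C ∨ y ∈ cellBelow s L C :=
  or_iff_not_imp_left.mpr fun hy => ⟨hy, x, hx, hyx⟩

theorem IsLeftCell.mem_cellBelow {C : Set G} (hC : IsLeftCell s L C) {x y : G}
    (hx : x ∈ cellBelow s L C) (hyx : LeftLE s L y x) : y ∈ cellBelow s L C := by
  obtain ⟨hx1, z, hz, hxz⟩ := hx
  refine ⟨fun hy => hx1 ?_, z, hz, hyx.trans hxz⟩
  obtain ⟨c, rfl⟩ := hC
  exact ⟨hxz.trans hz.1, hy.2.trans hyx⟩

/-- The index set of a basis of the left module attached to a pair of left cells. -/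
abbrev CellIdx (s : B → G) (L : G → Γ) (C C₁ : Set G) : Type _ :=
  C ⊕ (cellBelow s L C ⊕ cellBelow s L C₁)

section CellPair

variable {C C₁ : Set G} (φ : C ≃ C₁)

/-- The first component of an index. -/
def CellIdx.fst : CellIdx s L C C₁ → Option G
  | .inl u => some u
  | .inr (.inl u) => some u
  | .inr (.inr _) => none

/-- The second component of an index, after the bijection `φ`. -/
def CellIdx.snd : CellIdx s L C C₁ → Option G
  | .inl u => some (φ u)
  | .inr (.inl _) => none
  | .inr (.inr u) => some u

/-- The Kazhdan--Lusztig basis element, or zero. -/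
noncomputable def optKL (s : B → G) (L : G → Γ) (o : Option G) : Hecke s L := o.elim 0 (KL s L)

/-- The pairs `(C_u, C_{φ u})` for `u` in the cell, `(C_u, 0)` and `(0, C_u)` for `u` strictly
below the first and second cell. -/
noncomputable def cellPair (p : CellIdx s L C C₁) : Hecke s L × Hecke s L :=
  (optKL s L (CellIdx.fst p), optKL s L (CellIdx.snd φ p))

open Classical in
theorem linearCombination_filter_eq {R X M : Type*} [Semiring R] [AddCommMonoid M] [Module R M]
    (v : X → M) (C : Set X) (f : X →₀ R) :
    linearCombination R v f = linearCombination R (fun u : C => v u) (f.subtypeDomain (· ∈ C)) +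
      linearCombination R v (f.filter (· ∉ C)) := by
  have e : f.filter (· ∈ C) = (f.subtypeDomain (· ∈ C)).mapDomain Subtype.val := by
    ext y
    by_cases hy : y ∈ C
    · rw [Finsupp.filter_apply_pos _ _ hy]
      exact (Finsupp.mapDomain_apply (f := (Subtype.val : C → X)) Subtype.val_injective
        (f.subtypeDomain (· ∈ C)) ⟨y, hy⟩).symm
    · rw [Finsupp.filter_apply_neg _ _ hy, Finsupp.mapDomain_of_notMem_range]
      rintro ⟨u, rfl⟩
      exact hy u.2
  conv_lhs => rw [← Finsupp.filter_add_filter_not f (· ∈ C), map_add, e,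
    Finsupp.linearCombination_mapDomain]
  rfl

variable [IsOrderedAddMonoid Γ]

/-- Equal coefficients on the two cells are absorbed by the pairs (C_u, C_{φ u}). What remains lies
strictly below the cells, where each component may be adjusted independently. -/
theorem mem_span_cellPair (h : IsCoxeterWeight s L) {a b : Hecke s L}
    (ha : ∀ y, h.basisKL.repr a y ≠ 0 → y ∈ C ∨ y ∈ cellBelow s L C)
    (hb : ∀ y, h.basisKL.repr b y ≠ 0 → y ∈ C₁ ∨ y ∈ cellBelow s L C₁)
    (hab : ∀ u : C, h.basisKL.repr a u = h.basisKL.repr b (φ u)) :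
    (a, b) ∈ Submodule.span (CoeffRing Γ) (Set.range (cellPair (s := s) (L := L) φ)) := by
  classical
  have ea := h.basisKL.linearCombination_repr a
  have eb := h.basisKL.linearCombination_repr b
  rw [h.coe_basisKL] at ea eb
  rw [linearCombination_filter_eq _ C] at ea
  rw [linearCombination_filter_eq _ C₁] at eb
  set f := h.basisKL.repr a
  set f₁ := h.basisKL.repr b
  have e1 : f₁.subtypeDomain (· ∈ C₁) = (f.subtypeDomain (· ∈ C)).mapDomain φ := by
    ext u
    obtain ⟨u, rfl⟩ := φ.surjective u
    rw [Finsupp.mapDomain_apply φ.injective]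
    exact (hab u).symm
  have e2 : linearCombination (CoeffRing Γ) (fun u : C₁ => KL s L u)
      (f₁.subtypeDomain (· ∈ C₁)) = linearCombination (CoeffRing Γ) (fun u : C => KL s L (φ u))
      (f.subtypeDomain (· ∈ C)) := by
    rw [e1, Finsupp.linearCombination_mapDomain]
    rfl
  have e3 : (a, b) = linearCombination (CoeffRing Γ) (fun u : C => cellPair φ (Sum.inl u))
        (f.subtypeDomain (· ∈ C)) +
      (LinearMap.inl (CoeffRing Γ) _ _ (linearCombination _ (KL s L) (f.filter (· ∉ C))) +
        LinearMap.inr (CoeffRing Γ) _ _ (linearCombination _ (KL s L) (f₁.filter (· ∉ C₁)))) := by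
    refine Prod.ext ?_ ?_
    · rw [Prod.fst_add, Prod.fst_add,
        ← LinearMap.fst_apply (R := CoeffRing Γ) (linearCombination _ _ _),
        Finsupp.apply_linearCombination]
      simp only [LinearMap.inl_apply, LinearMap.inr_apply, add_zero]
      exact ea.symm
    · rw [Prod.snd_add, Prod.snd_add,
        ← LinearMap.snd_apply (R := CoeffRing Γ) (linearCombination _ _ _),
        Finsupp.apply_linearCombination]
      simp only [LinearMap.inl_apply, LinearMap.inr_apply, zero_add]
      rw [← eb, e2]
      rfl
  rw [e3]
  refine Submodule.add_mem _ ?_ (Submodule.add_mem _ ?_ ?_)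
  · rw [Finsupp.linearCombination_apply]
    exact Submodule.sum_mem _ fun u _ => Submodule.smul_mem _ _ (Submodule.subset_span ⟨_, rfl⟩)
  · rw [Finsupp.linearCombination_apply, Finsupp.sum, map_sum]
    refine Submodule.sum_mem _ fun u hu => ?_
    rw [map_smul]
    refine Submodule.smul_mem _ _ ?_
    rw [Finsupp.support_filter, Finset.mem_filter, Finsupp.mem_support_iff] at hu
    exact Submodule.subset_span ⟨.inr (.inl ⟨u, (ha u hu.1).resolve_left hu.2⟩), rfl⟩
  · rw [Finsupp.linearCombination_apply, Finsupp.sum, map_sum]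
    refine Submodule.sum_mem _ fun u hu => ?_
    rw [map_smul]
    refine Submodule.smul_mem _ _ ?_
    rw [Finsupp.support_filter, Finset.mem_filter, Finsupp.mem_support_iff] at hu
    exact Submodule.subset_span ⟨.inr (.inr ⟨u, (hb u hu.1).resolve_left hu.2⟩), rfl⟩

theorem Heart.repr_mul_eq (h : IsCoxeterWeight s L) {φ : C ≃ C₁} (hφ : Heart s L φ)
    (a : Hecke s L) (u v : C) :
    h.basisKL.repr (a * KL s L u) v = h.basisKL.repr (a * KL s L (φ u)) (φ v) := by
  have ha : a ∈ Submodule.span (CoeffRing Γ) (Set.range h.basisKL) := by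
    rw [h.basisKL.span_eq]; trivial
  induction ha using Submodule.span_induction with
  | mem x hx =>
    obtain ⟨w, rfl⟩ := hx
    rw [h.basisKL_apply, ← h.structConst_eq, ← h.structConst_eq, hφ w u v]
  | zero => simp only [zero_mul, map_zero, Finsupp.zero_apply]
  | add x y _ _ hx hy => simp only [add_mul, map_add, Finsupp.add_apply, hx, hy]
  | smul c x _ hx => simp only [smul_mul_assoc, map_smul, Finsupp.smul_apply, hx]

/-- The span of the `cellPair`s is a left ideal for the diagonal action. -/
theorem diag_mul_cellPair_mem (h : IsCoxeterWeight s L) (hC : IsLeftCell s L C)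
    (hC₁ : IsLeftCell s L C₁) {φ : C ≃ C₁} (hφ : Heart s L φ) (a : Hecke s L)
    (p : CellIdx s L C C₁) :
    (a, a) * cellPair φ p ∈
      Submodule.span (CoeffRing Γ) (Set.range (cellPair (s := s) (L := L) φ)) := by
  rcases p with u | u | u
  · exact mem_span_cellPair φ h
      (fun y hy => mem_or_mem_cellBelow u.2 (h.leftLE_of_repr_mul_ne a hy))
      (fun y hy => mem_or_mem_cellBelow (φ u).2 (h.leftLE_of_repr_mul_ne a hy))
      (hφ.repr_mul_eq h a u)
  · have h1 : ∀ y, h.basisKL.repr (a * KL s L u) y ≠ 0 → y ∈ cellBelow s L C := fun y hy =>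
      hC.mem_cellBelow u.2 (h.leftLE_of_repr_mul_ne a hy)
    have h2 : h.basisKL.repr (a * 0) = 0 := by rw [mul_zero, map_zero]
    refine mem_span_cellPair φ h (fun y hy => Or.inr (h1 y hy))
      (fun y hy => absurd (DFunLike.congr_fun h2 y) hy) fun v => ?_
    refine Eq.trans ?_ (DFunLike.congr_fun h2 _).symm
    by_contra hne
    exact (h1 v hne).1 v.2
  · have h1 : ∀ y, h.basisKL.repr (a * KL s L u) y ≠ 0 → y ∈ cellBelow s L C₁ := fun y hy =>
      hC₁.mem_cellBelow u.2 (h.leftLE_of_repr_mul_ne a hy)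
    have h2 : h.basisKL.repr (a * 0) = 0 := by rw [mul_zero, map_zero]
    refine mem_span_cellPair φ h (fun y hy => absurd (DFunLike.congr_fun h2 y) hy)
      (fun y hy => Or.inr (h1 y hy)) fun v => ?_
    refine (DFunLike.congr_fun h2 _).trans ?_
    by_contra hne
    exact (h1 _ (Ne.symm hne)).1 (φ v).2

end CellPair

end KLCells

namespace KLCells

open Finsupp (linearCombination)

variable {B W Γ : Type*} [Group W] [AddCommGroup Γ] [LinearOrder Γ]
  {M : CoxeterMatrix B} {cs : CoxeterSystem M W} {L : W → Γ} {I : Set B}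

/-! ### The parabolic subalgebra -/

/-- The embedding of the Iwahori--Hecke algebra of `W_I`. -/
noncomputable def parabolicMap (hL : IsPosWeightFunction cs L) (I : Set B) :
    Hecke (simpleI cs I) (weightI cs I L) →ₗ[CoeffRing Γ] Hecke cs.simple L :=
  (isCoxeterWeight_simpleI cs I hL).basisT.constr (CoeffRing Γ) fun u => T cs.simple L u

section ParabolicMap

variable (hL : IsPosWeightFunction cs L)

theorem parabolicMap_T (u : parabolic cs I) :
    parabolicMap hL I (T (simpleI cs I) (weightI cs I L) u) = T cs.simple L u := by
  rw [← (isCoxeterWeight_simpleI cs I hL).basisT_apply, parabolicMap, Module.Basis.constr_basis]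

theorem parabolicMap_one : parabolicMap hL I 1 = 1 := by
  rw [← (isCoxeterWeight_simpleI cs I hL).T_one, parabolicMap_T, Subgroup.coe_one,
    (isCoxeterWeight_simple cs hL).T_one]

theorem parabolicMap_Tgen_mul (i : I) (a : Hecke (simpleI cs I) (weightI cs I L)) :
    parabolicMap hL I (Tgen _ _ i * a) = Tgen cs.simple L i * parabolicMap hL I a := by
  have hI := isCoxeterWeight_simpleI cs I hL
  have h := isCoxeterWeight_simple cs hL
  induction a using hI.hecke_induction with
  | zero => rw [mul_zero, map_zero, mul_zero]
  | add a b ha hb => rw [mul_add, map_add, map_add, mul_add, ha, hb]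
  | smul c a ha => rw [mul_smul_comm, map_smul, map_smul, mul_smul_comm, ha]
  | T u =>
    rw [parabolicMap_T, h.Tgen_mul_T, hI.Tgen_mul_T]
    simp only [wordLength_simple, wordLength_simpleI]
    have e : ((simpleI cs I i * u : parabolic cs I) : W) = cs.simple i * u := rfl
    rw [e]
    split_ifs
    · rw [parabolicMap_T, e]
    · rw [map_add, map_smul, parabolicMap_T, parabolicMap_T, e]
      rfl

theorem parabolicMap_mul (a b : Hecke (simpleI cs I) (weightI cs I L)) :
    parabolicMap hL I (a * b) = parabolicMap hL I a * parabolicMap hL I b := by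
  have hI := isCoxeterWeight_simpleI cs I hL
  induction a using hI.hecke_induction with
  | zero => rw [zero_mul, map_zero, zero_mul]
  | add a a' ha hb => rw [add_mul, map_add, map_add, add_mul, ha, hb]
  | smul c a ha => rw [smul_mul_assoc, map_smul, map_smul, smul_mul_assoc, ha]
  | T w =>
    induction w using hI.left_induction with
    | one => rw [hI.T_one, parabolicMap_one, one_mul, one_mul]
    | mul i w hw ih =>
      rw [← hI.Tgen_mul_T_of_lt hw, mul_assoc, parabolicMap_Tgen_mul, ih, parabolicMap_Tgen_mul,
        mul_assoc]

/-- On T_u, both sides are inverse to T_{u⁻¹}. -/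
theorem barL_parabolicMap (a : Hecke (simpleI cs I) (weightI cs I L)) :
    barL (isCoxeterWeight_simple cs hL) (parabolicMap hL I a) =
      parabolicMap hL I (barL (isCoxeterWeight_simpleI cs I hL) a) := by
  have hI := isCoxeterWeight_simpleI cs I hL
  have h := isCoxeterWeight_simple cs hL
  induction a using hI.hecke_induction with
  | zero => simp only [map_zero]
  | add a b ha hb => simp only [map_add, ha, hb]
  | smul c a ha => simp only [map_smul, map_smulₛₗ, ha]
  | T u =>
    have h1 := congrArg (parabolicMap hL I) (hI.barL_T_mul_T_inv u)
    rw [parabolicMap_mul, parabolicMap_one, parabolicMap_T] at h1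
    rw [parabolicMap_T]
    exact (left_inv_eq_right_inv h1 (h.T_inv_mul_barL_T u)).symm

variable (I) in
/-- The element `T_z C_u` for `z ∈ X_I`, `u ∈ W_I`. -/
noncomputable def mixed (q : leftReps cs I × parabolic cs I) : Hecke cs.simple L :=
  T cs.simple L (q.1 : W) *
    parabolicMap hL I (KL (simpleI cs I) (weightI cs I L) q.2)

theorem T_mul_parabolicMap_T (z : leftReps cs I) (u : parabolic cs I) :
    T cs.simple L (z : W) * parabolicMap hL I (T (simpleI cs I) (weightI cs I L) u) =
      T cs.simple L (z * u) := by
  rw [parabolicMap_T, (isCoxeterWeight_simple cs hL).T_mul]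
  simp only [wordLength_simple]
  exact length_leftReps_mul cs z.2 u

theorem T_mul_parabolicMap_linearCombination (z : leftReps cs I)
    (f : parabolic cs I →₀ CoeffRing Γ) :
    T cs.simple L (z : W) * parabolicMap hL I
        (linearCombination (CoeffRing Γ) (T (simpleI cs I) (weightI cs I L)) f) =
      linearCombination (CoeffRing Γ) (fun u : parabolic cs I => T cs.simple L (z * u)) f := by
  rw [Finsupp.linearCombination_apply, Finsupp.linearCombination_apply, Finsupp.sum, map_sum,
    Finset.mul_sum]
  refine Finset.sum_congr rfl fun u _ => ?_
  rw [map_smul, mul_smul_comm, T_mul_parabolicMap_T]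

theorem coe_basisT_reindex :
    (fun q : leftReps cs I × parabolic cs I => T cs.simple L (q.1 * q.2)) =
      (isCoxeterWeight_simple cs hL).basisT.reindex (cosetEquiv cs I).symm := by
  funext q
  rw [Module.Basis.reindex_apply, Equiv.symm_symm, IsCoxeterWeight.basisT_apply]
  rfl

variable [IsOrderedAddMonoid Γ]

/-- Since T_z T_v = T_{zv} for v in W_I, the coefficients of T_z (C_u - T_u) are those of C_u - T_u.
-/
theorem isNegH_mixed_sub (z : leftReps cs I) (u : parabolic cs I) :
    IsNegH (mixed I hL (z, u) - T cs.simple L (z * u)) := by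
  have hI := isCoxeterWeight_simpleI cs I hL
  have h := isCoxeterWeight_simple cs hL
  have e := hI.basisT.linearCombination_repr
    (KL (simpleI cs I) (weightI cs I L) u - T (simpleI cs I) (weightI cs I L) u)
  rw [mixed, ← T_mul_parabolicMap_T hL, ← mul_sub, ← map_sub, ← e, hI.coe_basisT,
    T_mul_parabolicMap_linearCombination, Finsupp.linearCombination_apply]
  exact isNegH_sum fun v _ => h.isNegH_smul_T (hI.isNegH_KL_sub_T u v) _

theorem isUnitriangular_mixed :
    IsUnitriangular Γ (fun q : leftReps cs I × parabolic cs I => T cs.simple L (q.1 * q.2))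
      (mixed I hL) (fun q => wordLength (simpleI cs I) q.2) := by
  classical
  rintro ⟨z, u⟩
  obtain ⟨f, hf, e⟩ := (isCoxeterWeight_simpleI cs I hL).isUnitriangular_KL u
  have hinj : Function.Injective fun v : parabolic cs I => (z, v) := fun _ _ h =>
    (Prod.ext_iff.mp h).2
  refine ⟨f.mapDomain fun v => (z, v), mem_rankLT.mpr ?_, ?_⟩
  · rintro ⟨z', v⟩ hv
    by_cases hz : z' = z
    · subst hz
      rw [Finsupp.mapDomain_apply hinj]
      exact mem_rankLT.mp hf v hv
    · refine Finsupp.mapDomain_of_notMem_range _ _ ?_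
      rintro ⟨_, h⟩
      exact hz (Prod.ext_iff.mp h).1.symm
  · rw [mixed, e, map_add, mul_add, T_mul_parabolicMap_T, T_mul_parabolicMap_linearCombination,
      Finsupp.linearCombination_mapDomain]
    rfl

theorem linearIndependent_mixed : LinearIndependent (CoeffRing Γ) (mixed I hL) :=
  (isUnitriangular_mixed hL).linearIndependent
    (by rw [coe_basisT_reindex hL]; exact Module.Basis.linearIndependent _)

theorem span_mixed : ⊤ ≤ Submodule.span (CoeffRing Γ) (Set.range (mixed I hL)) := by
  refine le_trans ?_ (isUnitriangular_mixed hL).span_le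
  rw [coe_basisT_reindex hL, Module.Basis.span_eq]

variable (I) in
/-- The basis `(T_z C_u)` of the Iwahori--Hecke algebra. -/
noncomputable def mixedBasis :
    Module.Basis (leftReps cs I × parabolic cs I) (CoeffRing Γ) (Hecke cs.simple L) :=
  Module.Basis.mk (linearIndependent_mixed hL) (span_mixed hL)

theorem mixedBasis_apply (q : leftReps cs I × parabolic cs I) :
    mixedBasis I hL q = mixed I hL q :=
  Module.Basis.mk_apply (linearIndependent_mixed hL) (span_mixed hL) q

end ParabolicMap

end KLCells

namespace KLCells

open Finsupp (linearCombination)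

variable {B W Γ : Type*} [Group W] [AddCommGroup Γ] [LinearOrder Γ]
  {M : CoxeterMatrix B} {cs : CoxeterSystem M W} {L : W → Γ} {I : Set B}
  (hL : IsPosWeightFunction cs L) {C C₁ : Set (parabolic cs I)} (φ : C ≃ C₁)

/-! ### Induction of pairs of left cells -/

/-- The diagonal map `(a, b) ↦ (T_z a, T_z b)`. -/
noncomputable def inducePair (z : leftReps cs I) :
    (Hecke (simpleI cs I) (weightI cs I L) × Hecke (simpleI cs I) (weightI cs I L)) →ₗ[CoeffRing Γ]
      Hecke cs.simple L × Hecke cs.simple L :=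
  LinearMap.prodMap
    ((LinearMap.mulLeft (CoeffRing Γ) (T cs.simple L (z : W))).comp (parabolicMap hL I))
    ((LinearMap.mulLeft (CoeffRing Γ) (T cs.simple L (z : W))).comp (parabolicMap hL I))

/-- The pairs `(T_z C_u, T_z C_{φ u})`, `(T_z C_u, 0)` and `(0, T_z C_u)`. -/
noncomputable def mixedPair
    (q : leftReps cs I × CellIdx (simpleI cs I) (weightI cs I L) C C₁) :
    Hecke cs.simple L × Hecke cs.simple L :=
  inducePair hL q.1 (cellPair φ q.2)

/-- The pairs `(C_{zu}, C_{zφ(u)})`, `(C_{zu}, 0)` and `(0, C_{zu})`. -/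
noncomputable def inducedPair
    (q : leftReps cs I × CellIdx (simpleI cs I) (weightI cs I L) C C₁) :
    Hecke cs.simple L × Hecke cs.simple L :=
  (optKL cs.simple L ((CellIdx.fst q.2).map fun u => (q.1 : W) * u),
    optKL cs.simple L ((CellIdx.snd φ q.2).map fun u => (q.1 : W) * u))

/-- The bar involution on pairs. -/
noncomputable def barPair {B G : Type*} [Group G] {s : B → G} {L : G → Γ}
    (h : IsCoxeterWeight s L) :
    (Hecke s L × Hecke s L) →ₛₗ[barA (Γ := Γ)] Hecke s L × Hecke s L where
  toFun m := (barL h m.1, barL h m.2)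
  map_add' a b := by simp only [Prod.fst_add, Prod.snd_add, map_add, Prod.mk_add_mk]
  map_smul' c a := by simp only [Prod.smul_fst, Prod.smul_snd, map_smulₛₗ, Prod.smul_mk]

/-- The element `T_z C_u`, or zero. -/
noncomputable def optMixed (z : leftReps cs I) (o : Option (parabolic cs I)) :
    Hecke cs.simple L := o.elim 0 fun u => mixed I hL (z, u)

theorem mul_parabolicMap_optKL (z : leftReps cs I) (o : Option (parabolic cs I)) :
    T cs.simple L (z : W) * parabolicMap hL I (optKL (simpleI cs I) (weightI cs I L) o) =
      optMixed hL z o := by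
  cases o with
  | none => exact (congrArg _ (map_zero (parabolicMap hL I))).trans (mul_zero _)
  | some u => rfl

theorem mixedPair_eq (q : leftReps cs I × CellIdx (simpleI cs I) (weightI cs I L) C C₁) :
    mixedPair hL φ q =
      (optMixed hL q.1 (CellIdx.fst q.2), optMixed hL q.1 (CellIdx.snd φ q.2)) :=
  Prod.ext (mul_parabolicMap_optKL hL _ _) (mul_parabolicMap_optKL hL _ _)

/-- The span of the mixed pairs `t_{z,p}` with `l(z) < n`. -/
noncomputable def mixedSpan (n : ℕ) :
    Submodule (CoeffRing Γ) (Hecke cs.simple L × Hecke cs.simple L) :=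
  (rankLT Γ (fun q : leftReps cs I × CellIdx (simpleI cs I) (weightI cs I L) C C₁ =>
    cs.length (q.1 : W)) n).map (linearCombination (CoeffRing Γ) (mixedPair hL φ))

theorem mixedPair_mem_mixedSpan {n : ℕ}
    (q : leftReps cs I × CellIdx (simpleI cs I) (weightI cs I L) C C₁)
    (hq : cs.length (q.1 : W) < n) : mixedPair hL φ q ∈ mixedSpan hL φ n := by
  refine ⟨Finsupp.single q 1, mem_rankLT.mpr fun p hp => Finsupp.single_eq_of_ne ?_, ?_⟩
  · rintro rfl
    exact absurd hq (not_lt.mpr hp)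
  · rw [Finsupp.linearCombination_single, one_smul]

theorem mixedSpan_le (n : ℕ) : mixedSpan hL φ n ≤
    Submodule.span (CoeffRing Γ) (Set.range (mixedPair hL φ)) := by
  rintro _ ⟨f, -, rfl⟩
  rw [Finsupp.linearCombination_apply]
  exact Submodule.sum_mem _ fun q _ => Submodule.smul_mem _ _ (Submodule.subset_span ⟨q, rfl⟩)

theorem inducePair_mem {n : ℕ} {z : leftReps cs I} (hz : cs.length (z : W) < n)
    {m : Hecke (simpleI cs I) (weightI cs I L) × Hecke (simpleI cs I) (weightI cs I L)}
    (hm : m ∈ Submodule.span (CoeffRing Γ) (Set.range (cellPair φ))) :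
    inducePair hL z m ∈ mixedSpan hL φ n := by
  have : Submodule.span (CoeffRing Γ) (Set.range (cellPair φ)) ≤
      (mixedSpan hL φ n).comap (inducePair hL z) := by
    rw [Submodule.span_le]
    rintro _ ⟨p, rfl⟩
    exact mixedPair_mem_mixedSpan hL φ (z, p) hz
  exact this hm

/-- The diagonal embedding of `W_I`-pairs. -/
noncomputable def parabolicPair
    (m : Hecke (simpleI cs I) (weightI cs I L) × Hecke (simpleI cs I) (weightI cs I L)) :
    Hecke cs.simple L × Hecke cs.simple L :=
  (parabolicMap hL I m.1, parabolicMap hL I m.2)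

variable {φ} [IsOrderedAddMonoid Γ]
  (hC : IsLeftCell (simpleI cs I) (weightI cs I L) C)
  (hC₁ : IsLeftCell (simpleI cs I) (weightI cs I L) C₁)
  (hφ : Heart (simpleI cs I) (weightI cs I L) φ)

include hL hC hC₁ hφ

/-- Write w = xu, so T_w = T_x T_u. The factor T_u preserves the span of the cell pairs by (♡), and
T_x turns them into mixed pairs with l(x) ≤ l(w). -/
theorem T_mul_parabolicPair_mem (w : W) {n : ℕ} (hw : cs.length w < n)
    (p : CellIdx (simpleI cs I) (weightI cs I L) C C₁) :
    (T cs.simple L w, T cs.simple L w) * parabolicPair hL (cellPair φ p) ∈ mixedSpan hL φ n := by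
  obtain ⟨x, hx, u, rfl⟩ := exists_leftReps_mul cs I w
  rw [length_leftReps_mul cs hx] at hw
  have h1 := diag_mul_cellPair_mem (isCoxeterWeight_simpleI cs I hL) hC hC₁ hφ
    (T (simpleI cs I) (weightI cs I L) u) p
  have h2 := inducePair_mem hL φ (z := ⟨x, hx⟩) (n := n) (by simpa using by omega) h1
  convert h2 using 1
  refine Prod.ext ?_ ?_
  · change T cs.simple L (x * u) * parabolicMap hL I (cellPair φ p).1 =
      T cs.simple L x * parabolicMap hL I (T (simpleI cs I) (weightI cs I L) u * (cellPair φ p).1)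
    rw [parabolicMap_mul, ← mul_assoc]
    exact congrArg (· * _) (T_mul_parabolicMap_T hL ⟨x, hx⟩ u).symm
  · change T cs.simple L (x * u) * parabolicMap hL I (cellPair φ p).2 =
      T cs.simple L x * parabolicMap hL I (T (simpleI cs I) (weightI cs I L) u * (cellPair φ p).2)
    rw [parabolicMap_mul, ← mul_assoc]
    exact congrArg (· * _) (T_mul_parabolicMap_T hL ⟨x, hx⟩ u).symm

theorem linearCombination_mul_parabolicPair_mem {n : ℕ} {f : W →₀ CoeffRing Γ}
    (hf : f ∈ rankLT Γ (wordLength cs.simple) n)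
    (p : CellIdx (simpleI cs I) (weightI cs I L) C C₁) :
    (linearCombination (CoeffRing Γ) (T cs.simple L) f,
      linearCombination (CoeffRing Γ) (T cs.simple L) f) * parabolicPair hL (cellPair φ p) ∈
        mixedSpan hL φ n := by
  have e : (linearCombination (CoeffRing Γ) (T cs.simple L) f,
      linearCombination (CoeffRing Γ) (T cs.simple L) f) * parabolicPair hL (cellPair φ p) =
      ∑ w ∈ f.support, f w • ((T cs.simple L w, T cs.simple L w) *
        parabolicPair hL (cellPair φ p)) := by
    rw [Finsupp.linearCombination_apply, Finsupp.sum]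
    refine Prod.ext ?_ ?_
    · rw [Prod.fst_sum, Prod.fst_mul, Finset.sum_mul]
      exact Finset.sum_congr rfl fun w _ => smul_mul_assoc _ _ _
    · rw [Prod.snd_sum, Prod.snd_mul, Finset.sum_mul]
      exact Finset.sum_congr rfl fun w _ => smul_mul_assoc _ _ _
  rw [e]
  refine Submodule.sum_mem _ fun w hw => Submodule.smul_mem _ _
    (T_mul_parabolicPair_mem hL hC hC₁ hφ w ?_ p)
  by_contra hlt
  exact Finsupp.mem_support_iff.mp hw (mem_rankLT.mp hf w (by
    rw [wordLength_simple]; exact not_lt.mp hlt))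

/-- The span of the mixed pairs is a left ideal for the diagonal action. -/
theorem diag_mul_mem_span_mixedPair (a : Hecke cs.simple L)
    {m : Hecke cs.simple L × Hecke cs.simple L}
    (hm : m ∈ Submodule.span (CoeffRing Γ) (Set.range (mixedPair hL φ))) :
    (a, a) * m ∈ Submodule.span (CoeffRing Γ) (Set.range (mixedPair hL φ)) := by
  induction hm using Submodule.span_induction with
  | mem m hm =>
    obtain ⟨⟨z, p⟩, rfl⟩ := hm
    have e := (isCoxeterWeight_simple cs hL).basisT.linearCombination_repr
      (a * T cs.simple L (z : W))
    rw [IsCoxeterWeight.coe_basisT] at e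
    obtain ⟨n, hn⟩ := exists_mem_rankLT (wordLength cs.simple)
      ((isCoxeterWeight_simple cs hL).basisT.repr (a * T cs.simple L (z : W)))
    have h1 := mixedSpan_le hL φ n
      (linearCombination_mul_parabolicPair_mem hL hC hC₁ hφ hn p)
    rw [e] at h1
    convert h1 using 1
    exact Prod.ext (mul_assoc _ _ _).symm (mul_assoc _ _ _).symm
  | zero => rw [mul_zero]; exact Submodule.zero_mem _
  | add x y _ _ hx hy => rw [mul_add]; exact Submodule.add_mem _ hx hy
  | smul c x _ hx => rw [mul_smul_comm]; exact Submodule.smul_mem _ _ hx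

/-- The cell pairs are bar invariant, so only bar T_z contributes: its lower terms T_w send the pair
into mixed pairs with coset representatives shorter than z. -/
theorem isUnitriangular_mixedPair :
    IsUnitriangular Γ (mixedPair hL φ)
      (barPair (isCoxeterWeight_simple cs hL) ∘ mixedPair hL φ)
      (fun q => cs.length (q.1 : W)) := by
  rintro ⟨z, p⟩
  have h := isCoxeterWeight_simple cs hL
  obtain ⟨f, hf, e⟩ := h.isUnitriangular_barL (z : W)
  rw [wordLength_simple] at hf
  obtain ⟨g, hg, e1⟩ := linearCombination_mul_parabolicPair_mem hL hC hC₁ hφ hf p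
  refine ⟨g, hg, ?_⟩
  rw [e1]
  rw [Function.comp] at e
  have hopt : ∀ o : Option (parabolic cs I),
      barL h (parabolicMap hL I (optKL (simpleI cs I) (weightI cs I L) o)) =
        parabolicMap hL I (optKL (simpleI cs I) (weightI cs I L) o) := by
    intro o
    rw [barL_parabolicMap]
    cases o with
    | none => exact congrArg _ (map_zero _)
    | some u => exact congrArg _ ((isCoxeterWeight_simpleI cs I hL).barL_KL u)
  refine Prod.ext ?_ ?_
  · change barL h (T cs.simple L (z : W) * parabolicMap hL I (optKL _ _ _)) =
      T cs.simple L (z : W) * parabolicMap hL I (optKL _ _ _) + _ * parabolicMap hL I (optKL _ _ _)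
    rw [h.barL_mul, e, hopt, add_mul]
  · change barL h (T cs.simple L (z : W) * parabolicMap hL I (optKL _ _ _)) =
      T cs.simple L (z : W) * parabolicMap hL I (optKL _ _ _) + _ * parabolicMap hL I (optKL _ _ _)
    rw [h.barL_mul, e, hopt, add_mul]

omit hC hC₁ hφ in
theorem linearIndependent_mixedPair :
    LinearIndependent (CoeffRing Γ) (mixedPair hL φ) := by
  classical
  let b := mixedBasis I hL
  -- Coordinates in the basis T_z C_u, read in the first component except for the pairs (0, T_z
  -- C_u). The sets strictly below a cell are disjoint from it, so these functionals are dual to the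
  -- mixed pairs.
  let d : leftReps cs I × CellIdx (simpleI cs I) (weightI cs I L) C C₁ →
      Module.Dual (CoeffRing Γ) (Hecke cs.simple L × Hecke cs.simple L) := fun q =>
    match q with
    | (z, .inl u) => (b.coord (z, u)).comp (LinearMap.fst _ _ _)
    | (z, .inr (.inl u)) => (b.coord (z, u)).comp (LinearMap.fst _ _ _)
    | (z, .inr (.inr u)) => (b.coord (z, u)).comp (LinearMap.snd _ _ _)
  have hb : ∀ z z' u u', b.coord (z, u) (mixed I hL (z', u')) =
      if z' = z ∧ u' = u then 1 else 0 := by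
    intro z z' u u'
    rw [← mixedBasis_apply, Module.Basis.coord_apply, Module.Basis.repr_self,
      Finsupp.single_apply]
    simp only [Prod.mk.injEq]
  refine LinearIndependent.of_pairwise_dual_eq_zero_one _ d ?_ ?_
  · rintro ⟨z, u | u | u⟩ ⟨z', u' | u' | u'⟩ hne <;> rw [mixedPair_eq]
    · refine (hb z z' u u').trans (if_neg ?_)
      rintro ⟨rfl, h⟩
      exact hne (by rw [Subtype.ext h])
    · refine (hb z z' u u').trans (if_neg ?_)
      rintro ⟨rfl, h⟩
      exact u'.2.1 (h ▸ u.2)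
    · exact map_zero (b.coord _)
    · refine (hb z z' u u').trans (if_neg ?_)
      rintro ⟨rfl, h⟩
      exact u.2.1 (h ▸ u'.2)
    · refine (hb z z' u u').trans (if_neg ?_)
      rintro ⟨rfl, h⟩
      exact hne (by rw [Subtype.ext h])
    · exact map_zero (b.coord _)
    · refine (hb z z' u (φ u')).trans (if_neg ?_)
      rintro ⟨rfl, h⟩
      exact u.2.1 (h ▸ (φ u').2)
    · exact map_zero (b.coord _)
    · refine (hb z z' u u').trans (if_neg ?_)
      rintro ⟨rfl, h⟩
      exact hne (by rw [Subtype.ext h])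
  · rintro ⟨z, u | u | u⟩ <;> rw [mixedPair_eq] <;>
      exact (hb z z u u).trans (if_pos ⟨rfl, rfl⟩)

omit hC hC₁ hφ in
theorem isNegH_smul_optMixed {c : CoeffRing Γ} (hc : IsNegA c) (z : leftReps cs I)
    (o : Option (parabolic cs I)) : IsNegH (c • optMixed hL z o) := by
  cases o with
  | none =>
    rw [optMixed, Option.elim_none, smul_zero]
    exact isNegH_zero
  | some u => exact (isCoxeterWeight_simple cs hL).isNegH_smul hc (isNegH_mixed_sub hL z u)

omit hC hC₁ hφ in
-- Uniqueness of Kazhdan--Lusztig elements, with the index `none` covering the case where the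
-- component must be 0.
theorem eq_optKL_map {z : leftReps cs I} {o : Option (parabolic cs I)} {a : Hecke cs.simple L}
    (ha : IsNegH a)
    (hb : barL (isCoxeterWeight_simple cs hL) (optMixed hL z o + a) = optMixed hL z o + a) :
    optMixed hL z o + a = optKL cs.simple L (o.map fun u => (z : W) * u) := by
  have h := isCoxeterWeight_simple cs hL
  cases o with
  | none =>
    refine h.eq_zero_of_barL ?_ hb
    exact (zero_add a).symm ▸ ha
  | some u =>
    refine h.eq_KL hb ?_
    rw [add_sub_right_comm]
    exact (isNegH_mixed_sub hL z u).add ha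

/-- The decisive step: one family of coefficients makes the whole pair bar invariant, and uniqueness
in each component identifies the result. Hence C_{zu} and C_{zφ(u)} have matching expansions. -/
theorem isUnitriangular_inducedPair :
    IsUnitriangular Γ (mixedPair hL φ) (inducedPair φ) (fun q => cs.length (q.1 : W)) := by
  intro q
  have h := isCoxeterWeight_simple cs hL
  obtain ⟨f, hf, hneg, e⟩ := (isUnitriangular_mixedPair hL hC hC₁ hφ).exists_invariant
    (linearIndependent_mixedPair hL)
    (fun m => Prod.ext (h.barL_barL m.1) (h.barL_barL m.2)) q
  refine ⟨f, hf, ?_⟩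
  have h1 : (linearCombination (CoeffRing Γ) (mixedPair hL φ) f).1 =
      ∑ p ∈ f.support, f p • optMixed hL p.1 (CellIdx.fst p.2) := by
    rw [Finsupp.linearCombination_apply, Finsupp.sum, Prod.fst_sum]
    exact Finset.sum_congr rfl fun p _ => by rw [mixedPair_eq]; rfl
  have h2 : (linearCombination (CoeffRing Γ) (mixedPair hL φ) f).2 =
      ∑ p ∈ f.support, f p • optMixed hL p.1 (CellIdx.snd φ p.2) := by
    rw [Finsupp.linearCombination_apply, Finsupp.sum, Prod.snd_sum]
    exact Finset.sum_congr rfl fun p _ => by rw [mixedPair_eq]; rfl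
  rw [mixedPair_eq] at e ⊢
  refine Prod.ext (Eq.symm ?_) (Eq.symm ?_)
  · refine eq_optKL_map hL ?_ (congrArg Prod.fst e)
    rw [h1]
    exact isNegH_sum fun p _ => isNegH_smul_optMixed hL (hneg p) _ _
  · refine eq_optKL_map hL ?_ (congrArg Prod.snd e)
    rw [h2]
    exact isNegH_sum fun p _ => isNegH_smul_optMixed hL (hneg p) _ _

/-- By unitriangularity the induced and mixed pairs have the same span, and the latter is stable
under H. -/
theorem diag_mul_inducedPair_mem (a : Hecke cs.simple L)
    (q : leftReps cs I × CellIdx (simpleI cs I) (weightI cs I L) C C₁) :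
    (a, a) * inducedPair φ q ∈ Submodule.span (CoeffRing Γ)
      (Set.range (inducedPair (L := L) φ)) := by
  have h := isUnitriangular_inducedPair hL hC hC₁ hφ
  refine h.span_le (diag_mul_mem_span_mixedPair hL hC hC₁ hφ a ?_)
  obtain ⟨f, hf, e⟩ := h q
  rw [e, Finsupp.linearCombination_apply]
  exact Submodule.add_mem _ (Submodule.subset_span ⟨q, rfl⟩)
    (Submodule.sum_mem _ fun p _ => Submodule.smul_mem _ _ (Submodule.subset_span ⟨p, rfl⟩))

end KLCells

namespace KLCells

open Finsupp (linearCombination)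

/-! ### Transport of left cells along bijections satisfying (♡) -/

section Cells

variable {B G Γ : Type*} [Group G] [AddCommGroup Γ] [LinearOrder Γ] {s : B → G} {L : G → Γ}

theorem IsLeftCell.nonempty {D : Set G} (hD : IsLeftCell s L D) : D.Nonempty := by
  obtain ⟨x, rfl⟩ := hD
  exact ⟨x, LeftLE.refl x, LeftLE.refl x⟩

theorem IsLeftCell.leftLE {D : Set G} (hD : IsLeftCell s L D) {x y : G} (hx : x ∈ D)
    (hy : y ∈ D) : LeftLE s L x y := by
  obtain ⟨z, rfl⟩ := hD
  exact hx.1.trans hy.2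

theorem IsLeftCell.mem_of_leftLE {D : Set G} (hD : IsLeftCell s L D) {x y : G} (hx : x ∈ D)
    (h1 : LeftLE s L y x) (h2 : LeftLE s L x y) : y ∈ D := by
  obtain ⟨z, rfl⟩ := hD
  exact ⟨h1.trans hx.1, hx.2.trans h2⟩

theorem IsLeftCell.isUnionOfLeftCells {D : Set G} (hD : IsLeftCell s L D) :
    IsUnionOfLeftCells s L D :=
  ⟨{D}, fun _ h => h ▸ hD, (Set.sUnion_singleton D).symm⟩

theorem IsUnionOfLeftCells.mem_of_leftLE {X : Set G} (hX : IsUnionOfLeftCells s L X) {x y : G}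
    (hx : x ∈ X) (h1 : LeftLE s L y x) (h2 : LeftLE s L x y) : y ∈ X := by
  obtain ⟨𝒮, h𝒮, rfl⟩ := hX
  obtain ⟨D, hD, hxD⟩ := hx
  exact ⟨D, hD, (h𝒮 D hD).mem_of_leftLE hxD h1 h2⟩

theorem isUnionOfLeftCells_of_forall {X : Set G}
    (hX : ∀ x ∈ X, ∀ y, LeftLE s L y x → LeftLE s L x y → y ∈ X) :
    IsUnionOfLeftCells s L X := by
  refine ⟨{D | IsLeftCell s L D ∧ D ⊆ X}, fun D hD => hD.1, Set.Subset.antisymm ?_ ?_⟩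
  · exact fun x hx => ⟨_, ⟨⟨x, rfl⟩, fun y hy => hX x hx y hy.1 hy.2⟩, LeftLE.refl x, LeftLE.refl x⟩
  · rintro x ⟨D, hD, hx⟩
    exact hD.2 hx

variable {X X₁ : Set G}

theorem Heart.symm {Φ : X ≃ X₁} (hΦ : Heart s L Φ) : Heart s L Φ.symm := fun w x y => by
  rw [hΦ, Φ.apply_symm_apply, Φ.apply_symm_apply]

/-- Condition (♡) only compares elements of X. Since a and b are equivalent, every member of a chain
from a to b is in their left cell, hence in X, and each link can be transported. -/
theorem Heart.leftLE {Φ : X ≃ X₁} (hΦ : Heart s L Φ) (hX : IsUnionOfLeftCells s L X) {a b : X}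
    (hab : LeftLE s L (a : G) b) (hba : LeftLE s L (b : G) a) :
    LeftLE s L (Φ a : G) (Φ b) := by
  have key : ∀ a : G, LeftLE s L a b → ∀ ha : a ∈ X, LeftLE s L (b : G) a →
      LeftLE s L (Φ ⟨a, ha⟩ : G) (Φ b) := by
    intro a hab
    induction hab using Relation.ReflTransGen.head_induction_on with
    | refl => exact fun _ _ => LeftLE.refl _
    | head hac hcb ih =>
      rename_i a c
      intro ha hba
      have hbc := hba.trans (Relation.ReflTransGen.single hac)
      have hc := hX.mem_of_leftLE b.2 hcb hbc
      obtain ⟨i, hi⟩ := hac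
      refine LeftLE.trans (Relation.ReflTransGen.single ⟨i, ?_⟩) (ih hc hbc)
      rwa [← hΦ (s i) ⟨c, hc⟩ ⟨a, ha⟩]
  exact key a hab a.2 hba

/-- A bijection satisfying `Heart` matches the left cells of the two sets. -/
theorem Heart.exists_equiv_cells {Φ : X ≃ X₁} (hΦ : Heart s L Φ)
    (hX : IsUnionOfLeftCells s L X) (hX₁ : IsUnionOfLeftCells s L X₁) {𝒜 ℬ : Type*}
    {D : 𝒜 → Set G} {D₁ : ℬ → Set G} (hD : IsLeftCellPartition s L X D)
    (hD₁ : IsLeftCellPartition s L X₁ D₁) :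
    ∃ f : 𝒜 ≃ ℬ, ∀ α, CellApprox s L (D α) (D₁ (f α)) := by
  obtain ⟨hD1, hD2, hD3⟩ := hD
  obtain ⟨hE1, hE2, hE3⟩ := hD₁
  have hDX : ∀ α, D α ⊆ X := fun α => hD3 ▸ Set.subset_iUnion D α
  have hEX : ∀ β, D₁ β ⊆ X₁ := fun β => hE3 ▸ Set.subset_iUnion D₁ β
  choose x hx using fun α => (hD1 α).nonempty
  have hex : ∀ y : X₁, ∃ β, (y : G) ∈ D₁ β := fun y => Set.mem_iUnion.mp (hE3 ▸ y.2)
  have hex' : ∀ y : X, ∃ α, (y : G) ∈ D α := fun y => Set.mem_iUnion.mp (hD3 ▸ y.2)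
  choose f hf using fun α => hex (Φ ⟨x α, hDX α (hx α)⟩)
  have hto : ∀ α (y : X), (y : G) ∈ D α → (Φ y : G) ∈ D₁ (f α) := fun α y hy => by
    have h1 := (hD1 α).leftLE hy (hx α)
    have h2 := (hD1 α).leftLE (hx α) hy
    exact (hE1 _).mem_of_leftLE (hf α) (hΦ.leftLE hX (b := ⟨x α, hDX α (hx α)⟩) h1 h2)
      (hΦ.leftLE hX (a := ⟨x α, hDX α (hx α)⟩) h2 h1)
  have hback : ∀ α (y : X₁), (y : G) ∈ D₁ (f α) → (Φ.symm y : G) ∈ D α := fun α y hy => by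
    have h1 := hΦ.symm.leftLE hX₁ ((hE1 _).leftLE hy (hf α)) ((hE1 _).leftLE (hf α) hy)
    have h2 := hΦ.symm.leftLE hX₁ ((hE1 _).leftLE (hf α) hy) ((hE1 _).leftLE hy (hf α))
    rw [Φ.symm_apply_apply] at h1 h2
    exact (hD1 α).mem_of_leftLE (hx α) h1 h2
  have hbij : Function.Bijective f := by
    constructor
    · intro α α' h
      by_contra hne
      have h1 := hback α' _ (h ▸ hf α)
      rw [Φ.symm_apply_apply] at h1
      exact Set.disjoint_left.mp (hD2 hne) (hx α) h1
    · intro β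
      obtain ⟨y, hy⟩ := (hE1 β).nonempty
      obtain ⟨α, hα⟩ := hex' (Φ.symm ⟨y, hEX β hy⟩)
      refine ⟨α, by_contra fun hne => ?_⟩
      have h1 := hto α _ hα
      rw [Φ.apply_symm_apply] at h1
      exact Set.disjoint_left.mp (hE2 hne) h1 hy
  refine ⟨Equiv.ofBijective f hbij, fun α => ⟨(hD1 α).isUnionOfLeftCells,
    (hE1 _).isUnionOfLeftCells, ?_⟩⟩
  let e : D α ≃ D₁ (f α) :=
    { toFun := fun y => ⟨Φ ⟨y, hDX α y.2⟩, hto α _ y.2⟩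
      invFun := fun y => ⟨Φ.symm ⟨y, hEX _ y.2⟩, hback α _ y.2⟩
      left_inv := fun y => by simp
      right_inv := fun y => by simp }
  exact ⟨e, fun w y z => hΦ w ⟨y, hDX α y.2⟩ ⟨z, hDX α z.2⟩⟩

end Cells

/-! ### Structure constants and left cells of induced sets -/

section Induction

variable {B W Γ : Type*} [Group W] [AddCommGroup Γ] [LinearOrder Γ] [IsOrderedAddMonoid Γ]
  {M : CoxeterMatrix B} {cs : CoxeterSystem M W} {L : W → Γ} {I : Set B}
  (hL : IsPosWeightFunction cs L) {C C₁ : Set (parabolic cs I)} {φ : C ≃ C₁}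

open Classical in
theorem repr_optKL (z x : leftReps cs I) (o : Option (parabolic cs I)) (v : parabolic cs I) :
    (isCoxeterWeight_simple cs hL).basisKL.repr
        (optKL cs.simple L (o.map fun u => (x : W) * u)) (z * v) =
      if o = some v ∧ x = z then 1 else 0 := by
  have h := isCoxeterWeight_simple cs hL
  cases o with
  | none =>
    rw [if_neg (by simp)]
    exact DFunLike.congr_fun (map_zero h.basisKL.repr) _
  | some u =>
    change h.basisKL.repr (KL cs.simple L (x * u)) (z * v) = _
    rw [← h.basisKL_apply, h.basisKL.repr_self, Finsupp.single_apply]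
    refine if_congr ⟨fun e => ?_, ?_⟩ rfl rfl
    · obtain ⟨h1, h2⟩ := leftReps_mul_injective cs x.2 z.2 e
      exact ⟨congrArg some h2, Subtype.ext h1⟩
    · rintro ⟨h1, rfl⟩
      rw [Option.some_injective _ h1]

/-- The condition is linear, so spanning pairs suffice. Those from the cell match because φ is
injective and coset factorizations are unique; those from below have zero coefficient at both
places. -/
theorem repr_eq_of_mem_span_inducedPair {m : Hecke cs.simple L × Hecke cs.simple L}
    (hm : m ∈ Submodule.span (CoeffRing Γ) (Set.range (inducedPair (L := L) φ)))
    (z : leftReps cs I) (v : C) :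
    (isCoxeterWeight_simple cs hL).basisKL.repr m.1 (z * (v : parabolic cs I)) =
      (isCoxeterWeight_simple cs hL).basisKL.repr m.2 (z * (φ v : parabolic cs I)) := by
  classical
  induction hm using Submodule.span_induction with
  | mem m hm =>
    obtain ⟨⟨x, p⟩, rfl⟩ := hm
    refine (repr_optKL hL z x _ _).trans (Eq.trans ?_ (repr_optKL hL z x _ _).symm)
    refine if_congr (and_congr_left fun _ => ?_) rfl rfl
    rcases p with u | u | u
    · simp [CellIdx.fst, CellIdx.snd, Subtype.val_inj]
    · simp only [CellIdx.fst, CellIdx.snd, Option.some_inj, reduceCtorEq, iff_false]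
      exact fun e => u.2.1 (e ▸ v.2)
    · simp only [CellIdx.fst, CellIdx.snd, Option.some_inj, reduceCtorEq, false_iff]
      exact fun e => u.2.1 (e ▸ (φ v).2)
  | zero => simp only [Prod.fst_zero, Prod.snd_zero, map_zero, Finsupp.zero_apply]
  | add x y _ _ hx hy =>
    simp only [Prod.fst_add, Prod.snd_add, map_add, Finsupp.add_apply, hx, hy]
  | smul c x _ hx =>
    simp only [Prod.smul_fst, Prod.smul_snd, map_smul, Finsupp.smul_apply, hx]

theorem mem_of_mem_span_inducedPair {m : Hecke cs.simple L × Hecke cs.simple L}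
    (hm : m ∈ Submodule.span (CoeffRing Γ) (Set.range (inducedPair (L := L) φ)))
    (z : leftReps cs I) {v : parabolic cs I}
    (hv : ¬(v ∈ C ∨ v ∈ cellBelow (simpleI cs I) (weightI cs I L) C)) :
    (isCoxeterWeight_simple cs hL).basisKL.repr m.1 (z * v) = 0 := by
  classical
  induction hm using Submodule.span_induction with
  | mem m hm =>
    obtain ⟨⟨x, p⟩, rfl⟩ := hm
    refine (repr_optKL hL z x _ _).trans (if_neg ?_)
    rintro ⟨h1, -⟩
    rcases p with u | u | u
    · exact hv (Or.inl (Option.some_injective _ h1 ▸ u.2))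
    · exact hv (Or.inr (Option.some_injective _ h1 ▸ u.2))
    · exact absurd h1 (by simp [CellIdx.fst])
  | zero => simp only [Prod.fst_zero, map_zero, Finsupp.zero_apply]
  | add x y _ _ hx hy => simp only [Prod.fst_add, map_add, Finsupp.add_apply, hx, hy, add_zero]
  | smul c x _ hx => simp only [Prod.smul_fst, map_smul, Finsupp.smul_apply, hx, smul_zero]

variable (cs) in
/-- The bijection `X_I × C → X_I C`. -/
noncomputable def inducedEquiv (C : Set (parabolic cs I)) : leftReps cs I × C ≃ induced cs I C :=
  Equiv.ofBijective
    (fun p => ⟨p.1 * (p.2 : parabolic cs I), p.1, p.1.2, p.2, p.2.2, rfl⟩)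
    ⟨fun p q h => by
      obtain ⟨h1, h2⟩ := leftReps_mul_injective cs p.1.2 q.1.2 (Subtype.ext_iff.mp h)
      exact Prod.ext (Subtype.ext h1) (Subtype.ext h2),
    by
      rintro ⟨_, x, hx, u, hu, rfl⟩
      exact ⟨(⟨x, hx⟩, ⟨u, hu⟩), rfl⟩⟩

include hL

theorem structConst_induced (hC : IsLeftCell (simpleI cs I) (weightI cs I L) C)
    (hC₁ : IsLeftCell (simpleI cs I) (weightI cs I L) C₁)
    (hφ : Heart (simpleI cs I) (weightI cs I L) φ) (w : W) (x z : leftReps cs I) (u v : C) :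
    structConst cs.simple L w (x * (u : parabolic cs I)) (z * (v : parabolic cs I)) =
      structConst cs.simple L w (x * (φ u : parabolic cs I)) (z * (φ v : parabolic cs I)) := by
  have h := isCoxeterWeight_simple cs hL
  rw [h.structConst_eq, h.structConst_eq]
  exact repr_eq_of_mem_span_inducedPair hL
    (diag_mul_inducedPair_mem hL hC hC₁ hφ (KL cs.simple L w) (x, .inl u)) z v

/-- The left pre-order of `W` is compatible with that of `W_I`. -/
theorem leftLE_of_structConst_ne {w x z : W} (hx : x ∈ leftReps cs I) (hz : z ∈ leftReps cs I)
    {u v : parabolic cs I} (hne : structConst cs.simple L w (x * u) (z * v) ≠ 0) :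
    LeftLE (simpleI cs I) (weightI cs I L) v u := by
  have h := isCoxeterWeight_simple cs hL
  set C : Set (parabolic cs I) := {y | LeftLE (simpleI cs I) (weightI cs I L) y u ∧
    LeftLE (simpleI cs I) (weightI cs I L) u y} with hC_def
  have hC : IsLeftCell (simpleI cs I) (weightI cs I L) C := ⟨u, rfl⟩
  have hu : u ∈ C := ⟨LeftLE.refl u, LeftLE.refl u⟩
  -- With the identity bijection on the left cell of u, the first components of induced pairs only
  -- involve C_{zv} with v in or below that cell.
  have hmem := diag_mul_inducedPair_mem hL hC hC (φ := Equiv.refl C) (fun _ _ _ => rfl)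
    (KL cs.simple L w) (⟨x, hx⟩, .inl ⟨u, hu⟩)
  rw [h.structConst_eq] at hne
  have h1 : v ∈ C ∨ v ∈ cellBelow (simpleI cs I) (weightI cs I L) C := by
    by_contra hv
    exact hne (mem_of_mem_span_inducedPair hL hmem ⟨z, hz⟩ hv)
  rcases h1 with h1 | ⟨-, y, hy, hvy⟩
  · exact h1.1
  · exact hvy.trans hy.1

theorem leftLE_of_leftLE_mul {x z : W} (hx : x ∈ leftReps cs I) (hz : z ∈ leftReps cs I)
    {u v : parabolic cs I} (hle : LeftLE cs.simple L (z * v) (x * u)) :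
    LeftLE (simpleI cs I) (weightI cs I L) v u := by
  have key : ∀ w, LeftLE cs.simple L w (x * u) → ∀ z ∈ leftReps cs I, ∀ v : parabolic cs I,
      w = z * v → LeftLE (simpleI cs I) (weightI cs I L) v u := by
    intro w hw
    induction hw using Relation.ReflTransGen.head_induction_on with
    | refl =>
      intro z hz v e
      rw [(leftReps_mul_injective cs hx hz e).2]
      exact LeftLE.refl _
    | head hac hcb ih =>
      rename_i a c
      rintro z hz v rfl
      obtain ⟨y, hy, t, rfl⟩ := exists_leftReps_mul cs I c
      obtain ⟨i, hi⟩ := hac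
      exact (leftLE_of_structConst_ne hL hy hz hi).trans (ih y hy t rfl)
  exact key _ hle z hz v rfl

/-- Equivalent elements of W have equivalent W_I-factors, by compatibility of the pre-orders in both
directions. -/
theorem isUnionOfLeftCells_induced (hC : IsLeftCell (simpleI cs I) (weightI cs I L) C) :
    IsUnionOfLeftCells cs.simple L (induced cs I C) := by
  refine isUnionOfLeftCells_of_forall ?_
  rintro _ ⟨x, hx, u, hu, rfl⟩ y h1 h2
  obtain ⟨z, hz, v, rfl⟩ := exists_leftReps_mul cs I y
  exact ⟨z, hz, v, hC.mem_of_leftLE hu (leftLE_of_leftLE_mul hL hx hz h1)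
    (leftLE_of_leftLE_mul hL hz hx h2), rfl⟩

theorem exists_induced_heart (hC : IsLeftCell (simpleI cs I) (weightI cs I L) C)
    (hC₁ : IsLeftCell (simpleI cs I) (weightI cs I L) C₁)
    (hφ : Heart (simpleI cs I) (weightI cs I L) φ) :
    ∃ Φ : induced cs I C ≃ induced cs I C₁,
      (∀ (x : W) (hx : x ∈ leftReps cs I) (u : C),
        (Φ ⟨x * (u : parabolic cs I), x, hx, u, u.2, rfl⟩ : W) = x * (φ u : parabolic cs I)) ∧
      Heart cs.simple L Φ := by
  have key : ∀ (x : W) (hx : x ∈ leftReps cs I) (u : C),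
      (((inducedEquiv cs C).symm.trans
        (((Equiv.refl (leftReps cs I)).prodCongr φ).trans (inducedEquiv cs C₁)))
        ⟨x * (u : parabolic cs I), x, hx, u, u.2, rfl⟩ : W) = x * (φ u : parabolic cs I) := by
    intro x hx u
    have e : (⟨x * (u : parabolic cs I), x, hx, u, u.2, rfl⟩ : induced cs I C) =
      inducedEquiv cs C (⟨x, hx⟩, u) := rfl
    rw [e, Equiv.trans_apply, Equiv.symm_apply_apply]
    rfl
  refine ⟨_, key, ?_⟩
  rintro w ⟨_, x, hx, u, hu, rfl⟩ ⟨_, z, hz, v, hv, rfl⟩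
  rw [key x hx ⟨u, hu⟩, key z hz ⟨v, hv⟩]
  exact structConst_induced hL hC hC₁ hφ w ⟨x, hx⟩ ⟨z, hz⟩ ⟨u, hu⟩ ⟨v, hv⟩

end Induction

end KLCells

theorem proposition3p9 {B W Γ : Type*} [Finite B] [Group W]
    [AddCommGroup Γ] [LinearOrder Γ] [IsOrderedAddMonoid Γ]
    {M : CoxeterMatrix B} (cs : CoxeterSystem M W)
    (L : W → Γ) (hL : KLCells.IsPosWeightFunction cs L) (I : Set B)
    (C C₁ : Set (KLCells.parabolic cs I))
    (hC : KLCells.IsLeftCell (KLCells.simpleI cs I) (KLCells.weightI cs I L) C)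
    (hC₁ : KLCells.IsLeftCell (KLCells.simpleI cs I) (KLCells.weightI cs I L) C₁)
    (φ : C ≃ C₁)
    (hφ : KLCells.Heart (KLCells.simpleI cs I) (KLCells.weightI cs I L) φ) :
    (∃ Φ : KLCells.induced cs I C ≃ KLCells.induced cs I C₁,
      (∀ (x : W) (hx : x ∈ KLCells.leftReps cs I) (u : C),
        (Φ ⟨x * (u : KLCells.parabolic cs I), x, hx, u, u.2, rfl⟩ : W) =
          x * (φ u : KLCells.parabolic cs I)) ∧
      KLCells.Heart cs.simple L Φ) ∧
    KLCells.CellApprox cs.simple L (KLCells.induced cs I C) (KLCells.induced cs I C₁) ∧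
    ∀ (𝒜 ℬ : Type*) (D : 𝒜 → Set W) (D₁ : ℬ → Set W),
      KLCells.IsLeftCellPartition cs.simple L (KLCells.induced cs I C) D →
      KLCells.IsLeftCellPartition cs.simple L (KLCells.induced cs I C₁) D₁ →
      ∃ f : 𝒜 ≃ ℬ, ∀ α, KLCells.CellApprox cs.simple L (D α) (D₁ (f α)) := by
  obtain ⟨Φ, h1, h2⟩ := KLCells.exists_induced_heart hL hC hC₁ hφ
  have hU := KLCells.isUnionOfLeftCells_induced hL hC
  have hU₁ := KLCells.isUnionOfLeftCells_induced hL hC₁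
  exact ⟨⟨Φ, h1, h2⟩, ⟨hU, hU₁, Φ, h2⟩,
    fun 𝒜 ℬ D D₁ hD hD₁ => h2.exists_equiv_cells hU hU₁ hD hD₁⟩
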